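/- **Theorem.** Let $k\ge 1$, let $M$ be a smooth manifold of dimension $n=2k$, let $g$ be a smooth pseudo-Riemannian metric on $M$ (of any signature), let $\Upsilon\in C^\infty(M)$ and set $\widehat g:=e^{2\Upsilon}g$. *Conventions.* We use abstract index notation; indices are raised and lowered with the metric and $\nabla$ is the Levi-Civita connection. The curvature is $R_{ij}{}^k{}_\ell X^\ell=\nabla_i\nabla_jX^k-\nabla_j\nabla_iX^k$, the Ricci tensor is $R_{ij}=R_{ki}{}^k{}_j$, the scalar curvature is $R=R_k{}^k$, and for $n\ge3$ the Schouten, Weyl and Cotton tensors are $$P_{ij}=\tfrac1{n-2}\Bigl(R_{ij}-\tfrac{R}{2(n-1)}g_{ij}\Bigr),\qquad W_{ijkl}=R_{ijkl}-g_{ik}P_{jl}+g_{jk}P_{il}-g_{jl}P_{ik}+g_{il}P_{jk},\qquad C_{ijk}=\nabla_iP_{jk}-\nabla_jP_{ik},$$ so that $\nabla^pW_{ijpq}=(n-3)C_{ijq}$; for $n=2$ we put $W=0$ and $C=0$. The generalized Kronecker delta is $\delta_{i_1\dotsm i_m}^{j_1\dotsm j_m}=\det(\delta_{i_a}^{j_b})_{a,b=1}^m$.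 Put $$\operatorname{Pf}^{(k)}(W)=\frac1{k!}\,\delta_{i_1\dotsm i_{2k}}^{j_1\dotsm j_{2k}}W_{j_1j_2}{}^{i_1i_2}\dotsm W_{j_{2k-1}j_{2k}}{}^{i_{2k-1}i_{2k}},$$ $$\xi^{(k)}_i=\frac1{k!}\,\delta_{ii_2\dotsm i_{2k}}^{jj_2\dotsm j_{2k}}C_{jj_2}{}^{i_2}W_{j_3j_4}{}^{i_3i_4}\dotsm W_{j_{2k-1}j_{2k}}{}^{i_{2k-1}i_{2k}}+\frac1{2nk}\nabla_i\operatorname{Pf}^{(k)}(W).$$ A *homogeneous invariant polynomial of degree $k$* is a tensor $\Phi_{s_1\dotsm s_k}^{t_1\dotsm t_k}$ which is a real linear combination of the tensors $\delta_{s_1}^{t_{\sigma(1)}}\dotsm\delta_{s_k}^{t_{\sigma(k)}}$, $\sigma\in S_k$, and which satisfies $\Phi_{s_{\tau(1)}\dotsm s_{\tau(k)}}^{t_{\tau(1)}\dotsm t_{\tau(k)}}=\Phi_{s_1\dotsm s_k}^{t_1\dotsm t_k}$ for all $\tau\in S_k$. If $M$ is oriented and $\epsilon_{i_1\dotsm i_n}$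 is the pseudo-Riemannian volume form (equal to $\sqrt{|\det g|}\,dx^1\wedge\dotsm\wedge dx^n$ in positively oriented coordinates), put $$p_\Phi(W)=\frac1{(2k)!}\,\epsilon^{i_1\dotsm i_{2k}}\Phi_{s_1\dotsm s_k}^{t_1\dotsm t_k}W_{t_1}{}^{s_1}{}_{i_1i_2}\dotsm W_{t_k}{}^{s_k}{}_{i_{2k-1}i_{2k}},$$ $$\rho^\Phi_i=\frac1{(2k-1)!}\,\epsilon_i{}^{i_2\dotsm i_{2k}}\Phi_{s_1\dotsm s_k}^{t_1\dotsm t_k}C_{t_1}{}^{s_1}{}_{i_2}W_{t_2}{}^{s_2}{}_{i_3i_4}\dotsm W_{t_k}{}^{s_k}{}_{i_{2k-1}i_{2k}}+\frac1{2k}\nabla_ip_\Phi(W).$$ Let $\widehat\xi^{(k)}_i$ and $\widehat\rho^\Phi_i$ denote the one-forms defined in the same way in terms of $\widehat g$ (with the same orientation). *Conclusion.* 1. On $M$ it holds that $e^{2k\Upsilon}\,\widehat\xi^{(k)}_i=\xi^{(k)}_i$. 2. If $M$ is oriented and $\Phi$ is any homogeneous invariant polynomial of degree $k$, then $e^{2k\Upsilon}\,\widehat\rho^{\Phi}_i=\rho^\Phi_i$.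 In other words, $(\xi^{(k)}_i,g)\sim(\widehat\xi^{(k)}_i,\widehat g)$ and $(\rho^\Phi_i,g)\sim(\widehat\rho^\Phi_i,\widehat g)$ for the equivalence relation $(\omega_i,g)\sim(e^{-2k\Upsilon}\omega_i,e^{2\Upsilon}g)$ that defines one-forms of conformal weight $-2k$ (sections of $\mathcal E_i[-2k]$). -/

import Mathlib

open scoped Manifold ContDiff

noncomputable section

/-! ### Local Riemannian geometry in a coordinate domain

A metric in coordinates is a matrix-valued function `G` on `ℝⁿ`; `G y i j` is `g_{ij}` at `y`, and
`(G y)⁻¹ i j` is `g^{ij}`.  The order of the index arguments is the order in which the indices are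
written, the position (upper or lower) of each index is given in the doc comments. -/

namespace LocalGeometry

variable {n : ℕ}

/-- The partial derivative `∂_i f` of a function of `n` real variables. -/
def pderiv (i : Fin n) (f : EuclideanSpace ℝ (Fin n) → ℝ) (y : EuclideanSpace ℝ (Fin n)) : ℝ :=
  fderiv ℝ f y (EuclideanSpace.single i 1)

/-- Christoffel symbols `Γ^k_{ij}` of the Levi-Civita connection. -/
def christoffel (G : EuclideanSpace ℝ (Fin n) → Matrix (Fin n) (Fin n) ℝ)
    (y : EuclideanSpace ℝ (Fin n)) (k i j : Fin n) : ℝ :=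
  (1 / 2) * ∑ l, (G y)⁻¹ k l *
    (pderiv i (fun z => G z j l) y + pderiv j (fun z => G z i l) y
      - pderiv l (fun z => G z i j) y)

/-- The Riemann curvature tensor `R_{ij}{}^k{}_l` (index arguments in the order `i j k l`), with
`R_{ij}{}^k{}_l X^l = ∇_i ∇_j X^k - ∇_j ∇_i X^k`. -/
def riemannUp (G : EuclideanSpace ℝ (Fin n) → Matrix (Fin n) (Fin n) ℝ)
    (y : EuclideanSpace ℝ (Fin n)) (i j k l : Fin n) : ℝ :=
  pderiv i (fun z => christoffel G z k j l) y - pderiv j (fun z => christoffel G z k i l) y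
    + ∑ s, (christoffel G y k i s * christoffel G y s j l
      - christoffel G y k j s * christoffel G y s i l)

/-- `R_{ijkl}`. -/
def riemann (G : EuclideanSpace ℝ (Fin n) → Matrix (Fin n) (Fin n) ℝ)
    (y : EuclideanSpace ℝ (Fin n)) (i j k l : Fin n) : ℝ :=
  ∑ s, G y k s * riemannUp G y i j s l

/-- The Ricci tensor `R_{ij} = R_{ki}{}^k{}_j`. -/
def ricci (G : EuclideanSpace ℝ (Fin n) → Matrix (Fin n) (Fin n) ℝ)
    (y : EuclideanSpace ℝ (Fin n)) (i j : Fin n) : ℝ :=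
  ∑ k, riemannUp G y k i k j

/-- The scalar curvature `R = g^{ij} R_{ij}`. -/
def scalarCurv (G : EuclideanSpace ℝ (Fin n) → Matrix (Fin n) (Fin n) ℝ)
    (y : EuclideanSpace ℝ (Fin n)) : ℝ :=
  ∑ i, ∑ j, (G y)⁻¹ i j * ricci G y i j

/-- The Schouten tensor `P_{ij} = (R_{ij} - J g_{ij}) / (n - 2)`, with `J = R / (2 (n - 1))`.
(For `n = 2` it is not defined in the literature; here it is then zero.) -/
def schouten (G : EuclideanSpace ℝ (Fin n) → Matrix (Fin n) (Fin n) ℝ)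
    (y : EuclideanSpace ℝ (Fin n)) (i j : Fin n) : ℝ :=
  (1 / ((n : ℝ) - 2)) * (ricci G y i j - scalarCurv G y / (2 * ((n : ℝ) - 1)) * G y i j)

/-- The Weyl tensor `W_{ijkl}`, the trace-free part of `R_{ijkl}`; it vanishes for `n ≤ 2`. -/
def weyl (G : EuclideanSpace ℝ (Fin n) → Matrix (Fin n) (Fin n) ℝ)
    (y : EuclideanSpace ℝ (Fin n)) (i j k l : Fin n) : ℝ :=
  if n ≤ 2 then 0 else
    riemann G y i j k l
      - (G y i k * schouten G y j l - G y j k * schouten G y i l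
        + G y j l * schouten G y i k - G y i l * schouten G y j k)

/-- The covariant derivative `∇_i P_{jk}` of the Schouten tensor. -/
def covSchouten (G : EuclideanSpace ℝ (Fin n) → Matrix (Fin n) (Fin n) ℝ)
    (y : EuclideanSpace ℝ (Fin n)) (i j k : Fin n) : ℝ :=
  pderiv i (fun z => schouten G z j k) y
    - ∑ s, (christoffel G y s i j * schouten G y s k + christoffel G y s i k * schouten G y j s)

/-- The Cotton tensor `C_{ijk} = ∇_i P_{jk} - ∇_j P_{ik}`; for `n ≥ 3` this is the normalization
`∇^p W_{ijpq} = (n - 3) C_{ijq}`.  (For `n = 2` it is zero.) -/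
def cotton (G : EuclideanSpace ℝ (Fin n) → Matrix (Fin n) (Fin n) ℝ)
    (y : EuclideanSpace ℝ (Fin n)) (i j k : Fin n) : ℝ :=
  covSchouten G y i j k - covSchouten G y j i k

/-- `W_{ij}{}^{kl}`. -/
def weylUpUp (G : EuclideanSpace ℝ (Fin n) → Matrix (Fin n) (Fin n) ℝ)
    (y : EuclideanSpace ℝ (Fin n)) (i j k l : Fin n) : ℝ :=
  ∑ p, ∑ q, (G y)⁻¹ k p * (G y)⁻¹ l q * weyl G y i j p q

/-- `W_i{}^j{}_{kl}`. -/
def weylUp (G : EuclideanSpace ℝ (Fin n) → Matrix (Fin n) (Fin n) ℝ)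
    (y : EuclideanSpace ℝ (Fin n)) (i j k l : Fin n) : ℝ :=
  ∑ p, (G y)⁻¹ j p * weyl G y i p k l

/-- `C_{ij}{}^k`. -/
def cottonUpThird (G : EuclideanSpace ℝ (Fin n) → Matrix (Fin n) (Fin n) ℝ)
    (y : EuclideanSpace ℝ (Fin n)) (i j k : Fin n) : ℝ :=
  ∑ p, (G y)⁻¹ k p * cotton G y i j p

/-- `C_i{}^j{}_k`. -/
def cottonUpSecond (G : EuclideanSpace ℝ (Fin n) → Matrix (Fin n) (Fin n) ℝ)
    (y : EuclideanSpace ℝ (Fin n)) (i j k : Fin n) : ℝ :=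
  ∑ p, (G y)⁻¹ j p * cotton G y i p k

/-! ### Generalized Kronecker delta, and positions in tuples of length `2 k` -/

/-- The generalized Kronecker delta `δ_{i_1 … i_m}^{j_1 … j_m} = det (δ_{i_a}^{j_b})`. -/
def genDelta {m : ℕ} (I J : Fin m → Fin n) : ℝ :=
  (Matrix.of fun a b : Fin m => if I a = J b then (1 : ℝ) else 0).det

/-- The first position of the `a`-th consecutive pair in a tuple of length `2 k`
(pairs and positions are counted from zero). -/
def fstPos {k : ℕ} (a : Fin k) : Fin (2 * k) := ⟨2 * (a : ℕ), by omega⟩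

/-- The second position of the `a`-th consecutive pair in a tuple of length `2 k`. -/
def sndPos {k : ℕ} (a : Fin k) : Fin (2 * k) := ⟨2 * (a : ℕ) + 1, by omega⟩

/-! ### The Weyl Pfaffian and the one-form `ξ` -/

/-- `Pf^{(k)}(W) = (1 / k!) δ_{i_1 … i_{2k}}^{j_1 … j_{2k}} W_{j_1 j_2}{}^{i_1 i_2} ⋯
W_{j_{2k-1} j_{2k}}{}^{i_{2k-1} i_{2k}}`. -/
def pfaffianWeyl (k : ℕ) (G : EuclideanSpace ℝ (Fin n) → Matrix (Fin n) (Fin n) ℝ)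
    (y : EuclideanSpace ℝ (Fin n)) : ℝ :=
  (1 / (k.factorial : ℝ)) * ∑ I : Fin (2 * k) → Fin n, ∑ J : Fin (2 * k) → Fin n,
    genDelta I J *
      ∏ a : Fin k, weylUpUp G y (J (fstPos a)) (J (sndPos a)) (I (fstPos a)) (I (sndPos a))

/-- The components `ξ_i` of
`(1 / k!) δ_{i i_2 … i_{2k}}^{j j_2 … j_{2k}} C_{j j_2}{}^{i_2} W_{j_3 j_4}{}^{i_3 i_4} ⋯
W_{j_{2k-1} j_{2k}}{}^{i_{2k-1} i_{2k}} + (1 / (2 n k)) ∇_i Pf^{(k)}(W)`. -/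
def xi (k : ℕ) [NeZero k] (G : EuclideanSpace ℝ (Fin n) → Matrix (Fin n) (Fin n) ℝ)
    (y : EuclideanSpace ℝ (Fin n)) (i : Fin n) : ℝ :=
  (1 / (k.factorial : ℝ)) * ∑ I : Fin (2 * k) → Fin n, ∑ J : Fin (2 * k) → Fin n,
      (if I (fstPos 0) = i then
        genDelta I J * cottonUpThird G y (J (fstPos 0)) (J (sndPos 0)) (I (sndPos 0)) *
          ∏ a ∈ Finset.univ.erase (0 : Fin k),
            weylUpUp G y (J (fstPos a)) (J (sndPos a)) (I (fstPos a)) (I (sndPos a))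
      else 0)
    + (1 / (2 * (n : ℝ) * (k : ℝ))) * pderiv i (pfaffianWeyl k G) y

/-! ### Invariant polynomials, the volume form, and the one-form `ρ` -/

/-- `Φ s t` are the components `Φ_{s_1 … s_k}^{t_1 … t_k}` of a homogeneous invariant polynomial of
degree `k` in dimension `n`: a linear combination of compositions of `Id^{⊗ k}` with braiding maps
that is invariant under simultaneous permutations of the upper and lower indices. -/
def IsInvariantPolynomial (n k : ℕ) (Φ : (Fin k → Fin n) → (Fin k → Fin n) → ℝ) : Prop :=
  (∃ c : Equiv.Perm (Fin k) → ℝ, ∀ s t : Fin k → Fin n,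
      Φ s t = ∑ σ : Equiv.Perm (Fin k), c σ * ∏ a : Fin k, if s a = t (σ a) then (1 : ℝ) else 0) ∧
    ∀ (σ : Equiv.Perm (Fin k)) (s t : Fin k → Fin n),
      Φ (fun a => s (σ a)) (fun a => t (σ a)) = Φ s t

/-- The components `ε_{i_1 … i_n}` of the pseudo-Riemannian volume form
`√|det g| dx¹ ∧ ⋯ ∧ dxⁿ` in positively oriented coordinates. -/
def volForm (G : EuclideanSpace ℝ (Fin n) → Matrix (Fin n) (Fin n) ℝ)
    (y : EuclideanSpace ℝ (Fin n)) (I : Fin n → Fin n) : ℝ :=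
  √|(G y).det| * genDelta id I

/-- `p_Φ(W) = (1 / (2k)!) ε^{i_1 … i_n} Φ_{s_1 … s_k}^{t_1 … t_k} W_{t_1}{}^{s_1}{}_{i_1 i_2} ⋯
W_{t_k}{}^{s_k}{}_{i_{2k-1} i_{2k}}`, in dimension `n = 2 k`. -/
def pontrjaginWeyl (k : ℕ) (Φ : (Fin k → Fin (2 * k)) → (Fin k → Fin (2 * k)) → ℝ)
    (G : EuclideanSpace ℝ (Fin (2 * k)) → Matrix (Fin (2 * k)) (Fin (2 * k)) ℝ)
    (y : EuclideanSpace ℝ (Fin (2 * k))) : ℝ :=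
  (1 / ((2 * k).factorial : ℝ)) *
    ∑ I : Fin (2 * k) → Fin (2 * k),
      (∑ L : Fin (2 * k) → Fin (2 * k), volForm G y L * ∏ b, (G y)⁻¹ (L b) (I b)) *
        ∑ s : Fin k → Fin (2 * k), ∑ t : Fin k → Fin (2 * k),
          Φ s t * ∏ a : Fin k, weylUp G y (t a) (s a) (I (fstPos a)) (I (sndPos a))

/-- The components `ρ_i` of
`(1 / (2k-1)!) ε_i{}^{i_2 … i_{2k}} Φ_{s_1 … s_k}^{t_1 … t_k} C_{t_1}{}^{s_1}{}_{i_2}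
W_{t_2}{}^{s_2}{}_{i_3 i_4} ⋯ W_{t_k}{}^{s_k}{}_{i_{2k-1} i_{2k}} + (1 / (2k)) ∇_i p_Φ(W)`
in positively oriented coordinates, in dimension `n = 2 k`.  The tuples `I` and `L` below have first
entry `i`; the remaining entries of `L` are those of `ε`, raised to the remaining entries of `I`. -/
def rho (k : ℕ) [NeZero k] (Φ : (Fin k → Fin (2 * k)) → (Fin k → Fin (2 * k)) → ℝ)
    (G : EuclideanSpace ℝ (Fin (2 * k)) → Matrix (Fin (2 * k)) (Fin (2 * k)) ℝ)
    (y : EuclideanSpace ℝ (Fin (2 * k))) (i : Fin (2 * k)) : ℝ :=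
  (1 / ((2 * k - 1).factorial : ℝ)) *
      ∑ I : Fin (2 * k) → Fin (2 * k), (if I (fstPos 0) = i then
        (∑ L : Fin (2 * k) → Fin (2 * k), (if L (fstPos 0) = i then
            volForm G y L * ∏ b ∈ Finset.univ.erase (fstPos 0), (G y)⁻¹ (L b) (I b) else 0)) *
          ∑ s : Fin k → Fin (2 * k), ∑ t : Fin k → Fin (2 * k),
            Φ s t * cottonUpSecond G y (t 0) (s 0) (I (sndPos 0)) *
              ∏ a ∈ Finset.univ.erase (0 : Fin k),
                weylUp G y (t a) (s a) (I (fstPos a)) (I (sndPos a))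
      else 0)
    + (1 / (2 * (k : ℝ))) * pderiv i (pontrjaginWeyl k Φ G) y

end LocalGeometry

/-! ### Pseudo-Riemannian metrics on manifolds -/

section Manifolds

variable (n : ℕ) (M : Type*) [TopologicalSpace M] [ChartedSpace (EuclideanSpace ℝ (Fin n)) M]
  [IsManifold (𝓡 n) ∞ M]

/-- A smooth pseudo-Riemannian metric (of arbitrary signature) on an `n`-manifold. -/
structure PseudoRiemannianMetric where
  /-- The bilinear form on each tangent space. -/
  val (x : M) : TangentSpace (𝓡 n) x →L[ℝ] TangentSpace (𝓡 n) x →L[ℝ] ℝ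
  symm (x : M) (v w : TangentSpace (𝓡 n) x) : val x v w = val x w v
  nondegenerate (x : M) (v : TangentSpace (𝓡 n) x) (hv : ∀ w, val x v w = 0) : v = 0
  contMDiff : ContMDiff (𝓡 n)
    ((𝓡 n).prod 𝓘(ℝ, EuclideanSpace ℝ (Fin n) →L[ℝ] EuclideanSpace ℝ (Fin n) →L[ℝ] ℝ)) ∞
    (fun x => Bundle.TotalSpace.mk'
      (EuclideanSpace ℝ (Fin n) →L[ℝ] EuclideanSpace ℝ (Fin n) →L[ℝ] ℝ)
      (E := fun x : M => TangentSpace (𝓡 n) x →L[ℝ] TangentSpace (𝓡 n) x →L[ℝ] ℝ) x (val x))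

/-- An oriented atlas on an `n`-manifold: a family of smooth charts that cover the manifold, all of
whose transition maps have positive Jacobian determinant. -/
structure OrientedAtlas where
  /-- The positively oriented charts of the family. -/
  charts : Set (OpenPartialHomeomorph M (EuclideanSpace ℝ (Fin n)))
  subset_maximalAtlas : charts ⊆ IsManifold.maximalAtlas (𝓡 n) ∞ M
  covers (x : M) : ∃ φ ∈ charts, x ∈ φ.source
  det_pos : ∀ φ ∈ charts, ∀ ψ ∈ charts, ∀ y ∈ (φ.symm.trans ψ).source,
    0 < (fderiv ℝ (fun z => ψ (φ.symm z)) y).det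

variable {n M}

namespace PseudoRiemannianMetric

/-- The conformally related metric `e^{2Υ} g`. -/
def conformal (g : PseudoRiemannianMetric n M) (Υ : C^∞⟮𝓡 n, M; ℝ⟯) :
    PseudoRiemannianMetric n M where
  val x := Real.exp (2 * Υ x) • g.val x
  symm x v w := by simp [g.symm x v w]
  nondegenerate x v hv := by
    refine g.nondegenerate x v fun w => ?_
    have h := hv w
    simpa [Real.exp_ne_zero] using h
  contMDiff := by
    have h : ContMDiff (𝓡 n) 𝓘(ℝ, ℝ) ∞ (fun x => Real.exp (2 * Υ x)) :=
      (Real.contDiff_exp.comp (contDiff_const.mul contDiff_id)).contMDiff.comp Υ.contMDiff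
    exact h.smul_section g.contMDiff

/-- The matrix `g_{ij} = g(∂_i, ∂_j)` of the metric in the chart `φ`, as a function on the
coordinate domain. -/
def inChart (g : PseudoRiemannianMetric n M)
    (φ : OpenPartialHomeomorph M (EuclideanSpace ℝ (Fin n))) (y : EuclideanSpace ℝ (Fin n)) :
    Matrix (Fin n) (Fin n) ℝ :=
  Matrix.of fun i j => g.val (φ.symm y)
    (mfderiv (𝓡 n) (𝓡 n) φ.symm y (EuclideanSpace.single i (1 : ℝ)))
    (mfderiv (𝓡 n) (𝓡 n) φ.symm y (EuclideanSpace.single j (1 : ℝ)))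

end PseudoRiemannianMetric

/-- The covector `∑ i, c i • dx^i` at `x`, where `x^1, …, x^n` are the coordinates of the
chart `φ`. -/
def covectorInChart (φ : OpenPartialHomeomorph M (EuclideanSpace ℝ (Fin n))) (x : M)
    (c : Fin n → ℝ) : TangentSpace (𝓡 n) x →L[ℝ] ℝ :=
  ∑ i, c i • (EuclideanSpace.proj i : EuclideanSpace ℝ (Fin n) →L[ℝ] ℝ).comp
    (mfderiv (𝓡 n) (𝓡 n) φ x)

namespace PseudoRiemannianMetric

/-- The value at `x` of the one-form `ξ^{(k)}` of the metric `g`, computed in the chart `φ`. -/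
def xi (g : PseudoRiemannianMetric n M) (k : ℕ) [NeZero k]
    (φ : OpenPartialHomeomorph M (EuclideanSpace ℝ (Fin n))) (x : M) :
    TangentSpace (𝓡 n) x →L[ℝ] ℝ :=
  covectorInChart φ x (LocalGeometry.xi k (g.inChart φ) (φ x))

end PseudoRiemannianMetric

/-- The value at `x` of the one-form `ρ^Φ` of the metric `g` on an oriented `2k`-manifold, computed
in the positively oriented chart `φ`. -/
def PseudoRiemannianMetric.rho {k : ℕ} [NeZero k] {M : Type*} [TopologicalSpace M]
    [ChartedSpace (EuclideanSpace ℝ (Fin (2 * k))) M] [IsManifold (𝓡 (2 * k)) ∞ M]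
    (g : PseudoRiemannianMetric (2 * k) M)
    (Φ : (Fin k → Fin (2 * k)) → (Fin k → Fin (2 * k)) → ℝ)
    (φ : OpenPartialHomeomorph M (EuclideanSpace ℝ (Fin (2 * k)))) (x : M) :
    TangentSpace (𝓡 (2 * k)) x →L[ℝ] ℝ :=
  covectorInChart φ x (LocalGeometry.rho k Φ (g.inChart φ) (φ x))

end Manifolds

end

/-!
The statement is local: the charts are fixed, so it suffices to compare the metrics `g` and
`e^{2u} g` on an open subset of `ℝⁿ`, where `u` is the coordinate expression of `Υ`.

Write `u_i = ∂_i u` and `u^k = g^{kl} u_l`.  The Christoffel symbols change by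
`δ^k_i u_j + δ^k_j u_i - g_{ij} u^k` (`IsConformalOn.christoffel_eq`), and a computation with the
compatibility of metric and connection gives the change of the curvature
(`IsConformalOn.riemannUp_eq`) in terms of `A_{ij} = ∇_i u_j - u_i u_j + ½ u_s u^s g_{ij}`.  Hence
`P̂ = P - A`, the tensor `W_{ij}{}^k{}_l` is invariant, and the curl of `A` produces the curvature
acting on `du`, which yields `Ĉ_{ijk} = C_{ijk} + u^s W_{ijsk}` (`IsConformalOn.cotton_eq`).

The densities `Pf(W)` and `p_Φ(W)` have weight `-2k`, so that their gradients change by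
`-2k u_i` times the density.  This has to be cancelled by the term `u^s W_{ijsk}` coming from the
Cotton tensor.  The cancellation is an algebraic identity in the top degree `n = 2k`.  For any
array `X` indexed by `n`-tuples, contracting `ε_{… i …}` with `X^{… l …}` in one slot and summing
over the slots gives `δ_i^l ε_{i_1 … i_n} X^{i_1 … i_n}`; this is `adj(A) A = det A`
(`sum_leviCivita_update`, `sum_positions_contraction`).  For the products of Weyl tensors in
question all `n` slots contribute equally, because of the antisymmetry of `W` in a pair of indices
and the symmetry under exchange of pairs (`contraction_first_slot`).  So each slot contributes
`1 / n` of the full contraction, which is exactly what the normalization of the gradient terms in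
`ξ` and `ρ` requires.
-/

namespace LocalGeometry

/-! ### The Levi-Civita symbol and the trace identity in top degree -/

/-- The Levi-Civita symbol `ε_{i_1 … i_n}` of a tuple with values in its own index type. -/
noncomputable def leviCivita {n : ℕ} (I : Fin n → Fin n) : ℝ :=
  (Matrix.of fun a c : Fin n => if I a = c then (1 : ℝ) else 0).det

theorem genDelta_eq_mul {n : ℕ} (I J : Fin n → Fin n) :
    genDelta I J = leviCivita I * leviCivita J := by
  unfold genDelta leviCivita
  rw [← Matrix.det_transpose (Matrix.of fun a c : Fin n => if J a = c then (1 : ℝ) else 0),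
    ← Matrix.det_mul]
  congr 1
  ext a b
  simp [Matrix.mul_apply, eq_comm]

theorem genDelta_id {n : ℕ} (I : Fin n → Fin n) : genDelta id I = leviCivita I := by
  have h : leviCivita (id : Fin n → Fin n) = 1 := by
    unfold leviCivita
    exact (Matrix.det_one (n := Fin n) (R := ℝ))
  rw [genDelta_eq_mul, h, one_mul]

theorem leviCivita_comp_perm {n : ℕ} (I : Fin n → Fin n) (τ : Equiv.Perm (Fin n)) :
    leviCivita (fun a => I (τ a)) = (Equiv.Perm.sign τ : ℝ) * leviCivita I := by
  unfold leviCivita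
  rw [← Matrix.det_permute]
  rfl

/-- Multiplying a vector into one slot of `ε` at a time and summing over the slots gives a trace:
`∑_m δ^{i_m}_l ε_{i_1 … i … i_n} = δ_{il} ε_{i_1 … i_n}` with `i` in position `m`.  This is
`adj(A) A = det A` for the matrix `A` of unit rows determined by the tuple. -/
theorem sum_leviCivita_update {n : ℕ} (I : Fin n → Fin n) (i l : Fin n) :
    ∑ m, (if I m = l then leviCivita (Function.update I m i) else 0) =
      if i = l then leviCivita I else 0 := by
  set A : Matrix (Fin n) (Fin n) ℝ := Matrix.of fun a c : Fin n => if I a = c then (1 : ℝ) else 0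
    with hA
  have h := congrFun (congrFun (Matrix.adjugate_mul A) i) l
  rw [Matrix.mul_apply] at h
  have hu : ∀ m, Matrix.adjugate A i m = leviCivita (Function.update I m i) := by
    intro m
    rw [Matrix.adjugate_apply, leviCivita]
    congr 1
    ext a c
    by_cases ham : a = m
    · subst ham
      simp [Pi.single_apply, eq_comm]
    · simp [Matrix.updateRow_apply, ham, hA]
  simp only [hu] at h
  rw [Matrix.smul_apply, Matrix.one_apply, smul_eq_mul] at h
  have hd : A.det = leviCivita I := rfl
  rw [hd] at h
  rw [show (if i = l then leviCivita I else 0) = leviCivita I * (if i = l then 1 else 0) by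
    split_ifs <;> simp, ← h]
  refine Finset.sum_congr rfl fun m _ => ?_
  simp [hA]

/-- Exchanging the value of position `m` between `i` and `l` in a sum over tuples. -/
theorem sum_update_reindex {n : ℕ} {ι : Type*} [Fintype ι] [DecidableEq ι] (m : ι) (i l : Fin n)
    (F H : (ι → Fin n) → ℝ) :
    ∑ I, (if I m = i then F I * H (Function.update I m l) else 0) =
      ∑ I, (if I m = l then F (Function.update I m i) * H I else 0) := by
  rw [← Finset.sum_filter, ← Finset.sum_filter]
  refine Finset.sum_nbij' (fun I => Function.update I m l) (fun I => Function.update I m i)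
    ?_ ?_ ?_ ?_ ?_
  · intro I _; simp
  · intro I _; simp
  · intro I hI
    have : I m = i := by simpa using hI
    simp [← this]
  · intro I hI
    have : I m = l := by simpa using hI
    simp [← this]
  · intro I hI
    have : I m = i := by simpa using hI
    simp [← this]

/-- Summing over all positions `m`, the contraction of `ε_{… i …}` with `X^{… l …}` is
`δ_{il} ε_{i_1 … i_n} X^{i_1 … i_n}`. -/
theorem sum_positions_contraction {n : ℕ} (X : (Fin n → Fin n) → ℝ) (i l : Fin n) :
    ∑ m, ∑ I : Fin n → Fin n,
        (if I m = i then leviCivita I * X (Function.update I m l) else 0) =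
      if i = l then ∑ I, leviCivita I * X I else 0 := by
  simp_rw [sum_update_reindex]
  rw [Finset.sum_comm]
  have : ∀ I : Fin n → Fin n,
      ∑ m, (if I m = l then leviCivita (Function.update I m i) * X I else 0) =
        (if i = l then leviCivita I else 0) * X I := by
    intro I
    rw [← sum_leviCivita_update, Finset.sum_mul]
    refine Finset.sum_congr rfl fun m _ => ?_
    split_ifs <;> simp
  simp_rw [this]
  split_ifs <;> simp

/-- The function `X` on tuples changes by the sign of `τ` when its arguments are permuted
by `τ`. -/
noncomputable def AltUnder {n : ℕ} (X : (Fin n → Fin n) → ℝ) (τ : Equiv.Perm (Fin n)) : Prop :=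
  ∀ I, X (fun a => I (τ a)) = (Equiv.Perm.sign τ : ℝ) * X I

theorem AltUnder.mul {n : ℕ} {X : (Fin n → Fin n) → ℝ} {τ τ' : Equiv.Perm (Fin n)}
    (h : AltUnder X τ) (h' : AltUnder X τ') : AltUnder X (τ * τ') := by
  intro I
  have h1 := h' (fun a => I (τ a))
  simp only [Equiv.Perm.mul_apply, Equiv.Perm.sign_mul, h1, h I]
  push_cast
  ring

theorem sum_comp_perm {n : ℕ} {ι : Type*} [Fintype ι] [DecidableEq ι] (τ : Equiv.Perm ι)
    (F : (ι → Fin n) → ℝ) : ∑ I : ι → Fin n, F (fun a => I (τ a)) = ∑ I, F I :=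
  Fintype.sum_equiv (Equiv.arrowCongr τ.symm (Equiv.refl (Fin n))) _ _ fun _ => rfl

theorem sign_mul_self_real {n : ℕ} (τ : Equiv.Perm (Fin n)) :
    ((Equiv.Perm.sign τ : ℤ) : ℝ) * ((Equiv.Perm.sign τ : ℤ) : ℝ) = 1 := by
  rcases Int.units_eq_one_or (Equiv.Perm.sign τ) with h | h <;> simp [h]

theorem AltUnder.contraction_eq {n : ℕ} {X : (Fin n → Fin n) → ℝ} {τ : Equiv.Perm (Fin n)}
    (h : AltUnder X τ) (m i l : Fin n) :
    ∑ I : Fin n → Fin n, (if I m = i then leviCivita I * X (Function.update I m l) else 0) =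
      ∑ I : Fin n → Fin n,
        (if I (τ m) = i then leviCivita I * X (Function.update I (τ m) l) else 0) := by
  refine (sum_comp_perm τ _).symm.trans ?_
  refine Finset.sum_congr rfl fun I _ => ?_
  have hu : Function.update (fun a => I (τ a)) m l = fun a => Function.update I (τ m) l (τ a) := by
    funext a
    simp [Function.update_apply]
  rw [hu, h, leviCivita_comp_perm]
  split_ifs
  · linear_combination (leviCivita I * X (Function.update I (τ m) l)) * sign_mul_self_real τ
  · rfl

/-! ### Tuples of consecutive pairs -/

theorem fstPos_injective {k : ℕ} : Function.Injective (fstPos (k := k)) := by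
  intro a b h
  simp only [fstPos, Fin.mk.injEq] at h
  exact Fin.ext (by omega)

theorem sndPos_injective {k : ℕ} : Function.Injective (sndPos (k := k)) := by
  intro a b h
  simp only [sndPos, Fin.mk.injEq] at h
  exact Fin.ext (by omega)

theorem fstPos_ne_sndPos {k : ℕ} (a b : Fin k) : fstPos a ≠ sndPos b := by
  intro h
  simp only [fstPos, sndPos, Fin.mk.injEq] at h
  omega

/-- The permutation of positions exchanging the pairs number `a` and `b`. -/
noncomputable def pairSwap {k : ℕ} (a b : Fin k) : Equiv.Perm (Fin (2 * k)) :=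
  Equiv.swap (fstPos a) (fstPos b) * Equiv.swap (sndPos a) (sndPos b)

theorem pairSwap_fstPos {k : ℕ} (a b c : Fin k) :
    pairSwap a b (fstPos c) = fstPos (Equiv.swap a b c) := by
  rw [pairSwap, Equiv.Perm.mul_apply,
    Equiv.swap_apply_of_ne_of_ne (fstPos_ne_sndPos c a) (fstPos_ne_sndPos c b)]
  exact (fstPos_injective.map_swap a b c).symm

theorem pairSwap_sndPos {k : ℕ} (a b c : Fin k) :
    pairSwap a b (sndPos c) = sndPos (Equiv.swap a b c) := by
  rw [pairSwap, Equiv.Perm.mul_apply, ← sndPos_injective.map_swap,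
    Equiv.swap_apply_of_ne_of_ne (fstPos_ne_sndPos _ _).symm (fstPos_ne_sndPos _ _).symm]

theorem sign_pairSwap {k : ℕ} (a b : Fin k) : Equiv.Perm.sign (pairSwap a b) = 1 := by
  by_cases h : a = b
  · subst h
    simp [pairSwap]
  · simp [pairSwap, Equiv.Perm.sign_swap (fstPos_injective.ne h),
      Equiv.Perm.sign_swap (sndPos_injective.ne h)]

theorem swap_fstPos_sndPos_apply {k : ℕ} {a b : Fin k} (h : a ≠ b) :
    Equiv.swap (fstPos b) (sndPos b) (fstPos a) = fstPos a ∧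
      Equiv.swap (fstPos b) (sndPos b) (sndPos a) = sndPos a :=
  ⟨Equiv.swap_apply_of_ne_of_ne (fstPos_injective.ne h) (fstPos_ne_sndPos _ _),
    Equiv.swap_apply_of_ne_of_ne (fstPos_ne_sndPos _ _).symm (sndPos_injective.ne h)⟩

theorem eq_fstPos_or_eq_sndPos {k : ℕ} (m : Fin (2 * k)) :
    ∃ a : Fin k, m = fstPos a ∨ m = sndPos a := by
  refine ⟨⟨(m : ℕ) / 2, by omega⟩, ?_⟩
  rcases Nat.mod_two_eq_zero_or_one m with h | h
  · left; ext; simp only [fstPos]; omega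
  · right; ext; simp only [sndPos]; omega

/-- If `X` is antisymmetric in the first pair of positions and symmetric under exchange of pairs,
all `2k` slots contribute equally to `sum_positions_contraction`. -/
theorem contraction_first_slot {k : ℕ} [NeZero k] (X : (Fin (2 * k) → Fin (2 * k)) → ℝ)
    (h1 : AltUnder X (Equiv.swap (fstPos 0) (sndPos 0))) (h2 : ∀ a, AltUnder X (pairSwap 0 a))
    (i l : Fin (2 * k)) :
    (2 * (k : ℝ)) * ∑ I : Fin (2 * k) → Fin (2 * k),
        (if I (fstPos 0) = i then leviCivita I * X (Function.update I (fstPos 0) l) else 0) =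
      if i = l then ∑ I, leviCivita I * X I else 0 := by
  rw [← sum_positions_contraction]
  have key : ∀ m : Fin (2 * k), ∑ I : Fin (2 * k) → Fin (2 * k),
      (if I m = i then leviCivita I * X (Function.update I m l) else 0) =
      ∑ I : Fin (2 * k) → Fin (2 * k),
        (if I (fstPos 0) = i then leviCivita I * X (Function.update I (fstPos 0) l) else 0) := by
    intro m
    obtain ⟨a, rfl | rfl⟩ := eq_fstPos_or_eq_sndPos m
    · have := (h2 a).contraction_eq (fstPos 0) i l
      rw [pairSwap_fstPos, Equiv.swap_apply_left] at this
      exact this.symm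
    · have := ((h2 a).mul h1).contraction_eq (fstPos 0) i l
      rw [Equiv.Perm.mul_apply, Equiv.swap_apply_left, pairSwap_sndPos,
        Equiv.swap_apply_left] at this
      exact this.symm
  rw [Finset.sum_congr rfl fun m _ => key m]
  simp

/-- The right-hand side is the determinant of the matrix with rows `h^{* i_b}`; the sum is its
expansion by multilinearity in the rows. -/
theorem sum_leviCivita_mul_prod {n : ℕ} (h : Matrix (Fin n) (Fin n) ℝ) (I : Fin n → Fin n) :
    ∑ L : Fin n → Fin n, leviCivita L * ∏ b, h (L b) (I b) = h.det * leviCivita I := by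
  set B : Matrix (Fin n) (Fin n) ℝ := Matrix.of fun a c : Fin n => if I a = c then (1 : ℝ) else 0
  have h1 : h.det * leviCivita I = (B * h.transpose).det := by
    rw [Matrix.det_mul, Matrix.det_transpose, mul_comm]
    rfl
  rw [h1]
  have hrow : B * h.transpose =
      fun b => ∑ c, h c (I b) • (fun d => if c = d then (1 : ℝ) else 0) := by
    funext b d
    rw [Finset.sum_apply, Matrix.mul_apply]
    simp [B]
  rw [hrow]
  have := (Matrix.detRowAlternating (R := ℝ) (n := Fin n)).toMultilinearMap.map_sum
    (fun b c => h c (I b) • (fun d => if c = d then (1 : ℝ) else 0))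
  refine Eq.trans ?_ this.symm
  refine Finset.sum_congr rfl fun L _ => ?_
  rw [MultilinearMap.map_smul_univ, smul_eq_mul, mul_comm]
  rfl

variable {n : ℕ}

/-! ### Partial derivatives on an open set -/

section PartialDerivatives

variable {U : Set (EuclideanSpace ℝ (Fin n))} {y : EuclideanSpace ℝ (Fin n)}
  {f h : EuclideanSpace ℝ (Fin n) → ℝ}

theorem _root_.ContDiffOn.differentiableAt_of_isOpen (hf : ContDiffOn ℝ ∞ f U) (hU : IsOpen U)
    (hy : y ∈ U) : DifferentiableAt ℝ f y :=
  (hf.contDiffAt (hU.mem_nhds hy)).differentiableAt (by simp)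

theorem pderiv_congr (hU : IsOpen U) (hy : y ∈ U) (hfh : ∀ z ∈ U, f z = h z) (i : Fin n) :
    pderiv i f y = pderiv i h y := by
  have : f =ᶠ[nhds y] h := Filter.eventually_of_mem (hU.mem_nhds hy) hfh
  rw [pderiv, pderiv, this.fderiv_eq]

theorem contDiffOn_pderiv (hU : IsOpen U) (hf : ContDiffOn ℝ ∞ f U) (i : Fin n) :
    ContDiffOn ℝ ∞ (pderiv i f) U :=
  (hf.fderiv_of_isOpen hU (by simp)).clm_apply contDiffOn_const

theorem pderiv_const (c : ℝ) (i : Fin n) : pderiv i (fun _ => c) y = 0 := by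
  simp [pderiv]

theorem pderiv_add (hf : DifferentiableAt ℝ f y) (hh : DifferentiableAt ℝ h y) (i : Fin n) :
    pderiv i (fun z => f z + h z) y = pderiv i f y + pderiv i h y := by
  simp only [pderiv]
  rw [fderiv_fun_add hf hh]
  rfl

theorem pderiv_sub (hf : DifferentiableAt ℝ f y) (hh : DifferentiableAt ℝ h y) (i : Fin n) :
    pderiv i (fun z => f z - h z) y = pderiv i f y - pderiv i h y := by
  simp only [pderiv]
  rw [fderiv_fun_sub hf hh]
  rfl

theorem pderiv_mul (hf : DifferentiableAt ℝ f y) (hh : DifferentiableAt ℝ h y) (i : Fin n) :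
    pderiv i (fun z => f z * h z) y = pderiv i f y * h y + f y * pderiv i h y := by
  simp only [pderiv]
  rw [fderiv_fun_mul hf hh]
  simp only [add_apply, smul_apply, smul_eq_mul]
  ring

theorem pderiv_const_mul (c : ℝ) (hh : DifferentiableAt ℝ h y) (i : Fin n) :
    pderiv i (fun z => c * h z) y = c * pderiv i h y := by
  rw [pderiv_mul (differentiableAt_const c) hh, pderiv_const]
  ring

theorem pderiv_sum {ι : Type*} {s : Finset ι} {F : ι → EuclideanSpace ℝ (Fin n) → ℝ}
    (hF : ∀ a ∈ s, DifferentiableAt ℝ (F a) y) (i : Fin n) :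
    pderiv i (fun z => ∑ a ∈ s, F a z) y = ∑ a ∈ s, pderiv i (F a) y := by
  simp only [pderiv]
  rw [fderiv_fun_sum hF]
  simp

theorem pderiv_sum_mul {ι : Type*} [Fintype ι] {F H : ι → EuclideanSpace ℝ (Fin n) → ℝ}
    (hF : ∀ a, DifferentiableAt ℝ (F a) y) (hH : ∀ a, DifferentiableAt ℝ (H a) y) (i : Fin n) :
    pderiv i (fun z => ∑ a, F a z * H a z) y =
      ∑ a, pderiv i (F a) y * H a y + ∑ a, F a y * pderiv i (H a) y := by
  rw [pderiv_sum fun a _ => (hF a).fun_mul (hH a),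
    ← Finset.sum_add_distrib]
  exact Finset.sum_congr rfl fun a _ => pderiv_mul (hF a) (hH a) i

theorem pderiv_exp_mul (c : ℝ) (hf : DifferentiableAt ℝ f y) (i : Fin n) :
    pderiv i (fun z => Real.exp (c * f z)) y = Real.exp (c * f y) * (c * pderiv i f y) := by
  simp only [pderiv]
  rw [fderiv_exp (hf.const_mul c), fderiv_const_mul hf]
  simp

theorem pderiv_comm (hU : IsOpen U) (hf : ContDiffOn ℝ ∞ f U) (hy : y ∈ U) (i j : Fin n) :
    pderiv i (pderiv j f) y = pderiv j (pderiv i f) y := by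
  have hfy : ContDiffAt ℝ ∞ f y := hf.contDiffAt (hU.mem_nhds hy)
  have hd : DifferentiableAt ℝ (fderiv ℝ f) y :=
    (hfy.fderiv_right (m := 1) (by exact WithTop.coe_le_coe.2 le_top)).differentiableAt (by simp)
  have h2 : ∀ a b : Fin n, pderiv a (pderiv b f) y =
      fderiv ℝ (fderiv ℝ f) y (EuclideanSpace.single a 1) (EuclideanSpace.single b 1) := by
    intro a b
    unfold pderiv
    rw [fderiv_clm_apply hd (differentiableAt_const _)]
    simp
  rw [h2, h2]
  have hs : IsSymmSndFDerivAt ℝ f y := hfy.isSymmSndFDerivAt (by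
    simp only [minSmoothness_of_isRCLikeNormedField]
    exact WithTop.coe_le_coe.2 le_top)
  exact hs _ _

end PartialDerivatives

/-! ### The Levi-Civita connection of a metric on a coordinate domain -/

/-- `G` is a smooth pseudo-Riemannian metric on the open set `U`; no condition is imposed on the
values of `G` outside `U`. -/
structure IsMetricOn (G : EuclideanSpace ℝ (Fin n) → Matrix (Fin n) (Fin n) ℝ)
    (U : Set (EuclideanSpace ℝ (Fin n))) : Prop where
  isOpen : IsOpen U
  smooth : ∀ i j, ContDiffOn ℝ ∞ (fun z => G z i j) U
  symm : ∀ z ∈ U, ∀ i j, G z i j = G z j i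
  det_ne_zero : ∀ z ∈ U, (G z).det ≠ 0

theorem contDiffOn_det {m : ℕ} {U : Set (EuclideanSpace ℝ (Fin n))}
    {A : EuclideanSpace ℝ (Fin n) → Matrix (Fin m) (Fin m) ℝ}
    (hA : ∀ i j, ContDiffOn ℝ ∞ (fun z => A z i j) U) :
    ContDiffOn ℝ ∞ (fun z => (A z).det) U := by
  simp only [Matrix.det_apply']
  exact ContDiffOn.sum fun σ _ => contDiffOn_const.mul (contDiffOn_prod fun a _ => hA _ _)

/-- The Christoffel symbols with the first index lowered, `Γ_{lij} = g_{ls} Γ^s_{ij}`. -/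
noncomputable def christoffelLow (G : EuclideanSpace ℝ (Fin n) → Matrix (Fin n) (Fin n) ℝ)
    (y : EuclideanSpace ℝ (Fin n)) (l i j : Fin n) : ℝ :=
  ∑ s, G y l s * christoffel G y s i j

namespace IsMetricOn

variable {G : EuclideanSpace ℝ (Fin n) → Matrix (Fin n) (Fin n) ℝ}
  {U : Set (EuclideanSpace ℝ (Fin n))} {y : EuclideanSpace ℝ (Fin n)}

section Inverse

theorem isUnit_det (hG : IsMetricOn G U) (hy : y ∈ U) : IsUnit (G y).det :=
  isUnit_iff_ne_zero.2 (hG.det_ne_zero y hy)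

theorem inv_symm (hG : IsMetricOn G U) (hy : y ∈ U) (i j : Fin n) :
    (G y)⁻¹ i j = (G y)⁻¹ j i := by
  have h : (G y).transpose = G y := by
    ext a b
    exact hG.symm y hy b a
  have h2 := Matrix.transpose_nonsing_inv (G y)
  rw [h] at h2
  exact (congrFun (congrFun h2 j) i)

theorem sum_mul_inv (hG : IsMetricOn G U) (hy : y ∈ U) (i j : Fin n) :
    ∑ s, G y i s * (G y)⁻¹ s j = if i = j then 1 else 0 := by
  rw [← Matrix.mul_apply, Matrix.mul_nonsing_inv _ (hG.isUnit_det hy), Matrix.one_apply]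

theorem sum_inv_mul (hG : IsMetricOn G U) (hy : y ∈ U) (i j : Fin n) :
    ∑ s, (G y)⁻¹ i s * G y s j = if i = j then 1 else 0 := by
  rw [← Matrix.mul_apply, Matrix.nonsing_inv_mul _ (hG.isUnit_det hy), Matrix.one_apply]

/-- Lowering an index that was raised. -/
theorem lower_raise (hG : IsMetricOn G U) (hy : y ∈ U) (x : Fin n → ℝ) (l : Fin n) :
    ∑ s, G y l s * ∑ t, (G y)⁻¹ s t * x t = x l := by
  simp_rw [Finset.mul_sum, ← mul_assoc]
  rw [Finset.sum_comm]
  simp_rw [← Finset.sum_mul, hG.sum_mul_inv hy]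
  simp

/-- Raising an index that was lowered. -/
theorem raise_lower (hG : IsMetricOn G U) (hy : y ∈ U) (x : Fin n → ℝ) (l : Fin n) :
    ∑ s, (G y)⁻¹ l s * ∑ t, G y s t * x t = x l := by
  simp_rw [Finset.mul_sum, ← mul_assoc]
  rw [Finset.sum_comm]
  simp_rw [← Finset.sum_mul, hG.sum_inv_mul hy]
  simp

theorem smooth_inv (hG : IsMetricOn G U) (i j : Fin n) :
    ContDiffOn ℝ ∞ (fun z => (G z)⁻¹ i j) U := by
  have h : ∀ z ∈ U, (G z)⁻¹ i j = ((G z).det)⁻¹ * ((G z).updateRow j (Pi.single i 1)).det := by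
    intro z _
    rw [Matrix.inv_def, Matrix.smul_apply, Matrix.adjugate_apply, Ring.inverse_eq_inv, smul_eq_mul]
  refine ContDiffOn.congr ?_ h
  refine ((contDiffOn_det hG.smooth).inv hG.det_ne_zero).mul (contDiffOn_det fun a b => ?_)
  by_cases ha : a = j
  · subst ha
    simpa using contDiffOn_const
  · simpa [Matrix.updateRow_apply, ha] using hG.smooth a b

end Inverse

theorem smooth_christoffel (hG : IsMetricOn G U) (k i j : Fin n) :
    ContDiffOn ℝ ∞ (fun z => christoffel G z k i j) U :=
  contDiffOn_const.mul (ContDiffOn.sum fun l _ => (hG.smooth_inv k l).mul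
    (((contDiffOn_pderiv hG.isOpen (hG.smooth j l) i).add
      (contDiffOn_pderiv hG.isOpen (hG.smooth i l) j)).sub
      (contDiffOn_pderiv hG.isOpen (hG.smooth i j) l)))

theorem smooth_riemannUp (hG : IsMetricOn G U) (i j k l : Fin n) :
    ContDiffOn ℝ ∞ (fun z => riemannUp G z i j k l) U :=
  ((contDiffOn_pderiv hG.isOpen (hG.smooth_christoffel k j l) i).sub
    (contDiffOn_pderiv hG.isOpen (hG.smooth_christoffel k i l) j)).add
    (ContDiffOn.sum fun s _ =>
      ((hG.smooth_christoffel k i s).mul (hG.smooth_christoffel s j l)).sub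
      ((hG.smooth_christoffel k j s).mul (hG.smooth_christoffel s i l)))

theorem smooth_ricci (hG : IsMetricOn G U) (i j : Fin n) :
    ContDiffOn ℝ ∞ (fun z => ricci G z i j) U :=
  ContDiffOn.sum fun k _ => hG.smooth_riemannUp k i k j

theorem smooth_schouten (hG : IsMetricOn G U) (i j : Fin n) :
    ContDiffOn ℝ ∞ (fun z => schouten G z i j) U :=
  contDiffOn_const.mul ((hG.smooth_ricci i j).sub
    (((ContDiffOn.sum fun a _ => ContDiffOn.sum fun b _ =>
      (hG.smooth_inv a b).mul (hG.smooth_ricci a b)).div_const _).mul (hG.smooth i j)))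

theorem smooth_weyl (hG : IsMetricOn G U) (i j k l : Fin n) :
    ContDiffOn ℝ ∞ (fun z => weyl G z i j k l) U := by
  unfold weyl
  split_ifs
  · exact contDiffOn_const
  · have h : ∀ a b c d, ContDiffOn ℝ ∞ (fun z => G z a b * schouten G z c d) U :=
      fun a b c d => (hG.smooth a b).mul (hG.smooth_schouten c d)
    exact (ContDiffOn.sum fun s _ => (hG.smooth k s).mul (hG.smooth_riemannUp i j s l)).sub
      ((((h _ _ _ _).sub (h _ _ _ _)).add (h _ _ _ _)).sub (h _ _ _ _))

theorem pderiv_symm (hG : IsMetricOn G U) (hy : y ∈ U) (i j k : Fin n) :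
    pderiv i (fun z => G z j k) y = pderiv i (fun z => G z k j) y :=
  pderiv_congr hG.isOpen hy (fun z hz => hG.symm z hz j k) i

theorem christoffel_symm (hG : IsMetricOn G U) (hy : y ∈ U) (k i j : Fin n) :
    christoffel G y k i j = christoffel G y k j i := by
  unfold christoffel
  congr 1
  refine Finset.sum_congr rfl fun l _ => ?_
  rw [hG.pderiv_symm hy l i j]
  ring

theorem christoffelLow_eq (hG : IsMetricOn G U) (hy : y ∈ U) (l i j : Fin n) :
    christoffelLow G y l i j = (1 / 2) * (pderiv i (fun z => G z j l) y
      + pderiv j (fun z => G z i l) y - pderiv l (fun z => G z i j) y) := by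
  unfold christoffelLow christoffel
  simp_rw [mul_left_comm _ (1 / 2 : ℝ)]
  rw [← Finset.mul_sum, hG.lower_raise hy
    (fun l => pderiv i (fun z => G z j l) y + pderiv j (fun z => G z i l) y
      - pderiv l (fun z => G z i j) y)]

theorem christoffelLow_symm (hG : IsMetricOn G U) (hy : y ∈ U) (k i j : Fin n) :
    christoffelLow G y k i j = christoffelLow G y k j i := by
  unfold christoffelLow
  exact Finset.sum_congr rfl fun l _ => by rw [hG.christoffel_symm hy]

/-- Compatibility of the metric with the connection, `∇_i g_{jk} = 0`. -/
theorem pderiv_metric (hG : IsMetricOn G U) (hy : y ∈ U) (i j k : Fin n) :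
    pderiv i (fun z => G z j k) y = christoffelLow G y k i j + christoffelLow G y j i k := by
  rw [hG.christoffelLow_eq hy, hG.christoffelLow_eq hy, hG.pderiv_symm hy i k j,
    hG.pderiv_symm hy j i k]
  ring

theorem smooth_christoffelLow (hG : IsMetricOn G U) (k i j : Fin n) :
    ContDiffOn ℝ ∞ (fun z => christoffelLow G z k i j) U :=
  ContDiffOn.sum fun s _ => (hG.smooth k s).mul (hG.smooth_christoffel s i j)

/-! ### Symmetries of the curvature -/

theorem sum_metric_pderiv_christoffel (hG : IsMetricOn G U) (hy : y ∈ U) (i j k l : Fin n) :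
    ∑ s, G y k s * pderiv i (fun z => christoffel G z s j l) y =
      pderiv i (fun z => christoffelLow G z k j l) y
        - ∑ s, christoffelLow G y s i k * christoffel G y s j l
        - ∑ s, christoffelLow G y k i s * christoffel G y s j l := by
  have h : pderiv i (fun z => christoffelLow G z k j l) y = _ :=
    pderiv_sum_mul (fun s => (hG.smooth k s).differentiableAt_of_isOpen hG.isOpen hy)
      (fun s => (hG.smooth_christoffel s j l).differentiableAt_of_isOpen hG.isOpen hy) i
  rw [h]
  simp_rw [hG.pderiv_metric hy, add_mul, Finset.sum_add_distrib]
  ring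

theorem sum_metric_christoffel_mul (i j k l : Fin n) :
    ∑ s, G y k s * ∑ t, christoffel G y s i t * christoffel G y t j l =
      ∑ t, christoffelLow G y k i t * christoffel G y t j l := by
  simp_rw [Finset.mul_sum, ← mul_assoc]
  rw [Finset.sum_comm]
  simp_rw [← Finset.sum_mul]
  rfl

/-- `R_{ijkl}` in terms of the lowered Christoffel symbols, a form in which the antisymmetry in
`k` and `l` follows from `∂_i g_{kl} = Γ_{kil} + Γ_{lik}`. -/
theorem riemann_eq (hG : IsMetricOn G U) (hy : y ∈ U) (i j k l : Fin n) :
    riemann G y i j k l =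
      pderiv i (fun z => christoffelLow G z k j l) y
        - pderiv j (fun z => christoffelLow G z k i l) y
        - ∑ s, christoffelLow G y s i k * christoffel G y s j l
        + ∑ s, christoffelLow G y s j k * christoffel G y s i l := by
  simp only [riemann, riemannUp, mul_add, mul_sub, Finset.sum_add_distrib, Finset.sum_sub_distrib,
    hG.sum_metric_pderiv_christoffel hy, sum_metric_christoffel_mul]
  ring

theorem sum_christoffelLow_mul_comm (hG : IsMetricOn G U) (hy : y ∈ U) (i j k l : Fin n) :
    ∑ s, christoffelLow G y s i k * christoffel G y s j l =
      ∑ s, christoffelLow G y s j l * christoffel G y s i k := by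
  simp only [christoffelLow, Finset.sum_mul]
  rw [Finset.sum_comm]
  refine Finset.sum_congr rfl fun s _ => Finset.sum_congr rfl fun t _ => ?_
  rw [hG.symm y hy]
  ring

theorem riemann_antisymm_right (hG : IsMetricOn G U) (hy : y ∈ U) (i j k l : Fin n) :
    riemann G y i j k l = -riemann G y i j l k := by
  rw [hG.riemann_eq hy, hG.riemann_eq hy, hG.sum_christoffelLow_mul_comm hy i j k l,
    hG.sum_christoffelLow_mul_comm hy j i k l]
  have hd : ∀ a b : Fin n, pderiv a (fun z => christoffelLow G z k b l) y
      + pderiv a (fun z => christoffelLow G z l b k) y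
      = pderiv a (pderiv b (fun z => G z l k)) y := by
    intro a b
    rw [← pderiv_add ((hG.smooth_christoffelLow k b l).differentiableAt_of_isOpen hG.isOpen hy)
      ((hG.smooth_christoffelLow l b k).differentiableAt_of_isOpen hG.isOpen hy)]
    exact pderiv_congr hG.isOpen hy (fun z hz => (hG.pderiv_metric hz b l k).symm) a
  linear_combination hd i j - hd j i + pderiv_comm hG.isOpen (hG.smooth l k) hy i j

theorem riemannUp_antisymm_left (i j k l : Fin n) :
    riemannUp G y i j k l = -riemannUp G y j i k l := by
  simp only [riemannUp, Finset.sum_sub_distrib]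
  ring

theorem riemannUp_eq_raise (hG : IsMetricOn G U) (hy : y ∈ U) (i j k l : Fin n) :
    riemannUp G y i j k l = ∑ s, (G y)⁻¹ k s * riemann G y i j s l :=
  (hG.raise_lower hy (fun s => riemannUp G y i j s l) k).symm

theorem first_bianchi (hG : IsMetricOn G U) (hy : y ∈ U) (i j k l : Fin n) :
    riemannUp G y i j k l + riemannUp G y j l k i + riemannUp G y l i k j = 0 := by
  have hd : ∀ a b c : Fin n, pderiv a (fun z => christoffel G z k b c) y
      = pderiv a (fun z => christoffel G z k c b) y :=
    fun a b c => pderiv_congr hG.isOpen hy (fun z hz => hG.christoffel_symm hz k b c) a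
  simp only [riemannUp, Finset.sum_sub_distrib]
  rw [hd i j l, hd j i l, hd l j i]
  simp only [hG.christoffel_symm hy _ l j, hG.christoffel_symm hy _ l i,
    hG.christoffel_symm hy _ j i]
  ring

theorem riemannUp_trace (hG : IsMetricOn G U) (hy : y ∈ U) (i j : Fin n) :
    ∑ k, riemannUp G y i j k k = 0 := by
  have h : ∑ k, riemannUp G y i j k k = -∑ k, riemannUp G y i j k k := by
    simp_rw [hG.riemannUp_eq_raise hy]
    rw [← Finset.sum_neg_distrib]
    simp_rw [← Finset.sum_neg_distrib]
    rw [Finset.sum_comm]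
    refine Finset.sum_congr rfl fun s _ => Finset.sum_congr rfl fun t _ => ?_
    rw [hG.inv_symm hy t s, hG.riemann_antisymm_right hy i j s t]
    ring
  linarith

theorem ricci_symm (hG : IsMetricOn G U) (hy : y ∈ U) (i j : Fin n) :
    ricci G y i j = ricci G y j i := by
  have h : ∑ k, (riemannUp G y k i k j + riemannUp G y i j k k + riemannUp G y j k k i) = 0 :=
    Finset.sum_eq_zero fun k _ => hG.first_bianchi hy k i k j
  rw [Finset.sum_add_distrib, Finset.sum_add_distrib, hG.riemannUp_trace hy] at h
  simp_rw [fun k => riemannUp_antisymm_left (G := G) (y := y) j k k i] at h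
  rw [Finset.sum_neg_distrib] at h
  unfold ricci
  linarith

theorem schouten_symm (hG : IsMetricOn G U) (hy : y ∈ U) (i j : Fin n) :
    schouten G y i j = schouten G y j i := by
  rw [schouten, schouten, hG.ricci_symm hy, hG.symm y hy]

theorem weyl_antisymm_right (hG : IsMetricOn G U) (hy : y ∈ U) (i j k l : Fin n) :
    weyl G y i j k l = -weyl G y i j l k := by
  unfold weyl
  split_ifs
  · simp
  · rw [hG.riemann_antisymm_right hy]
    ring

end IsMetricOn

/-! ### Gradient and Hessian of the conformal factor -/

section ConformalFactor

variable (G : EuclideanSpace ℝ (Fin n) → Matrix (Fin n) (Fin n) ℝ)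
  (u : EuclideanSpace ℝ (Fin n) → ℝ) (y : EuclideanSpace ℝ (Fin n))

/-- The gradient `u^k = g^{kl} ∂_l u`. -/
noncomputable def grad (k : Fin n) : ℝ := ∑ l, (G y)⁻¹ k l * pderiv l u y

/-- The Hessian `∇_i ∇_j u`. -/
noncomputable def hess (i j : Fin n) : ℝ :=
  pderiv i (pderiv j u) y - ∑ s, pderiv s u y * christoffel G y s i j

/-- The squared length `u_s u^s` of the gradient. -/
noncomputable def gradSq : ℝ := ∑ s, pderiv s u y * grad G u y s

/-- The covariant derivative `∇_i u^k` of the gradient. -/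
noncomputable def covGrad (i k : Fin n) : ℝ :=
  pderiv i (fun z => grad G u z k) y + ∑ s, christoffel G y k i s * grad G u y s

/-- The tensor `A_{ij} = ∇_i u_j - u_i u_j + ½ u_s u^s g_{ij}`, the amount by which the Schouten
tensor decreases when the metric is multiplied by `e^{2u}`. -/
noncomputable def schoutenChange (i j : Fin n) : ℝ :=
  hess G u y i j - pderiv i u y * pderiv j u y + (1 / 2) * gradSq G u y * G y i j

/-- The tensor `δ^k_i u_j + δ^k_j u_i - g_{ij} u^k`, the amount by which the Christoffel symbols
increase when the metric is multiplied by `e^{2u}`. -/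
noncomputable def christoffelChange (k i j : Fin n) : ℝ :=
  (if k = i then pderiv j u y else 0) + (if k = j then pderiv i u y else 0)
    - G y i j * grad G u y k

variable {G u y}

theorem sum_christoffelChange_mul (k i : Fin n) (x : Fin n → ℝ) :
    ∑ s, christoffelChange G u y k i s * x s =
      (if k = i then ∑ s, pderiv s u y * x s else 0) + pderiv i u y * x k
        - grad G u y k * ∑ s, G y i s * x s := by
  simp only [christoffelChange, add_mul, sub_mul, Finset.sum_add_distrib, Finset.sum_sub_distrib,
    ite_mul, zero_mul, Finset.sum_ite_eq, Finset.mem_univ, if_true, Finset.mul_sum]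
  congr 1
  · congr 1
    split_ifs <;> simp
  · exact Finset.sum_congr rfl fun s _ => by ring

theorem sum_mul_christoffelChange (j l : Fin n) (x : Fin n → ℝ) :
    ∑ s, x s * christoffelChange G u y s j l =
      x j * pderiv l u y + x l * pderiv j u y - G y j l * ∑ s, x s * grad G u y s := by
  simp only [christoffelChange, mul_add, mul_sub, Finset.sum_add_distrib, Finset.sum_sub_distrib,
    mul_ite, mul_zero, Finset.sum_ite_eq', Finset.mem_univ, if_true, Finset.mul_sum]
  congr 1
  exact Finset.sum_congr rfl fun s _ => by ring

variable {U : Set (EuclideanSpace ℝ (Fin n))}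

theorem IsMetricOn.lower_grad (hG : IsMetricOn G U) (hy : y ∈ U) (l : Fin n) :
    ∑ s, G y l s * grad G u y s = pderiv l u y :=
  hG.lower_raise hy (fun s => pderiv s u y) l

theorem IsMetricOn.smooth_grad (hG : IsMetricOn G U) (hu : ContDiffOn ℝ ∞ u U) (k : Fin n) :
    ContDiffOn ℝ ∞ (fun z => grad G u z k) U :=
  ContDiffOn.sum fun l _ => (hG.smooth_inv k l).mul (contDiffOn_pderiv hG.isOpen hu l)

theorem IsMetricOn.smooth_gradSq (hG : IsMetricOn G U) (hu : ContDiffOn ℝ ∞ u U) :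
    ContDiffOn ℝ ∞ (fun z => gradSq G u z) U :=
  ContDiffOn.sum fun l _ => (contDiffOn_pderiv hG.isOpen hu l).mul (hG.smooth_grad hu l)

theorem IsMetricOn.hess_symm (hG : IsMetricOn G U) (hu : ContDiffOn ℝ ∞ u U) (hy : y ∈ U)
    (i j : Fin n) : hess G u y i j = hess G u y j i := by
  simp only [hess, pderiv_comm hG.isOpen hu hy i j, hG.christoffel_symm hy _ i j]

/-- Lowering an index commutes with the covariant derivative, for the gradient. -/
theorem IsMetricOn.lower_covGrad (hG : IsMetricOn G U) (hu : ContDiffOn ℝ ∞ u U) (hy : y ∈ U)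
    (i l : Fin n) : ∑ k, G y l k * covGrad G u y i k = hess G u y i l := by
  have h1 : pderiv i (fun z => ∑ k, G z l k * grad G u z k) y = pderiv i (pderiv l u) y :=
    pderiv_congr hG.isOpen hy (fun z hz => hG.lower_grad hz l) i
  rw [pderiv_sum_mul (fun k => (hG.smooth l k).differentiableAt_of_isOpen hG.isOpen hy)
    (fun k => (hG.smooth_grad hu k).differentiableAt_of_isOpen hG.isOpen hy)] at h1
  simp_rw [hG.pderiv_metric hy, add_mul] at h1
  rw [Finset.sum_add_distrib] at h1
  have h2 : ∑ k, christoffelLow G y k i l * grad G u y k =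
      ∑ s, pderiv s u y * christoffel G y s i l := by
    simp_rw [← hG.lower_grad (u := u) hy, christoffelLow, Finset.sum_mul]
    rw [Finset.sum_comm]
    refine Finset.sum_congr rfl fun s _ => Finset.sum_congr rfl fun t _ => ?_
    rw [hG.symm y hy s t]
    ring
  have h3 : ∑ k, christoffelLow G y l i k * grad G u y k =
      ∑ k, G y l k * ∑ s, christoffel G y k i s * grad G u y s := by
    simp_rw [christoffelLow, Finset.sum_mul, Finset.mul_sum]
    rw [Finset.sum_comm]
    exact Finset.sum_congr rfl fun s _ => Finset.sum_congr rfl fun t _ => by ring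
  simp only [covGrad, hess, mul_add, Finset.sum_add_distrib]
  linarith

/-- `∂_i (u_s u^s) = 2 u^s ∇_i u_s`. -/
theorem IsMetricOn.pderiv_gradSq (hG : IsMetricOn G U) (hu : ContDiffOn ℝ ∞ u U) (hy : y ∈ U)
    (i : Fin n) :
    pderiv i (fun z => gradSq G u z) y = 2 * ∑ s, hess G u y i s * grad G u y s := by
  have h1 : pderiv i (fun z => gradSq G u z) y = _ :=
    pderiv_sum_mul (fun s => (contDiffOn_pderiv hG.isOpen hu s).differentiableAt_of_isOpen
      hG.isOpen hy) (fun s => (hG.smooth_grad hu s).differentiableAt_of_isOpen hG.isOpen hy) i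
  have h2 : ∑ s, pderiv s u y * covGrad G u y i s = ∑ s, hess G u y i s * grad G u y s := by
    simp_rw [← hG.lower_covGrad hu hy, ← hG.lower_grad (u := u) hy, Finset.sum_mul]
    rw [Finset.sum_comm]
    refine Finset.sum_congr rfl fun s _ => Finset.sum_congr rfl fun t _ => ?_
    rw [hG.symm y hy s t]
    ring
  have h3 : ∑ s, hess G u y i s * grad G u y s =
      ∑ s, pderiv i (pderiv s u) y * grad G u y s
        - ∑ s, pderiv s u y * ∑ t, christoffel G y s i t * grad G u y t := by
    simp_rw [hess, sub_mul, Finset.sum_sub_distrib, Finset.sum_mul, Finset.mul_sum]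
    congr 1
    rw [Finset.sum_comm]
    exact Finset.sum_congr rfl fun s _ => Finset.sum_congr rfl fun t _ => by ring
  simp only [covGrad, mul_add, Finset.sum_add_distrib] at h2
  rw [h1]
  linarith

theorem IsMetricOn.schoutenChange_symm (hG : IsMetricOn G U) (hu : ContDiffOn ℝ ∞ u U)
    (hy : y ∈ U) (i j : Fin n) : schoutenChange G u y i j = schoutenChange G u y j i := by
  rw [schoutenChange, schoutenChange, hG.hess_symm hu hy, hG.symm y hy i j]
  ring

/-- `A_i{}^k` in terms of the covariant derivative of the gradient. -/
theorem IsMetricOn.raise_schoutenChange (hG : IsMetricOn G U) (hu : ContDiffOn ℝ ∞ u U)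
    (hy : y ∈ U) (i k : Fin n) :
    ∑ s, (G y)⁻¹ k s * schoutenChange G u y i s =
      covGrad G u y i k - pderiv i u y * grad G u y k
        + (if k = i then (1 / 2) * gradSq G u y else 0) := by
  have h : ∀ s, schoutenChange G u y i s = ∑ t, G y s t * (covGrad G u y i t
      - pderiv i u y * grad G u y t + (if t = i then (1 / 2) * gradSq G u y else 0)) := by
    intro s
    simp only [mul_add, mul_sub, Finset.sum_add_distrib, Finset.sum_sub_distrib,
      mul_left_comm _ (pderiv i u y), ← Finset.mul_sum, hG.lower_grad hy, hG.lower_covGrad hu hy,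
      mul_ite, mul_zero, Finset.sum_ite_eq', Finset.mem_univ, if_true, schoutenChange]
    rw [hG.symm y hy s i]
    ring
  simp_rw [h]
  exact hG.raise_lower hy _ k

end ConformalFactor

/-! ### Conformal change of the curvature -/

/-- On the open set `U`, `G` is a smooth metric, `u` is a smooth function, and `G'` is the
conformally related metric `e^{2u} G`. -/
structure IsConformalOn (G G' : EuclideanSpace ℝ (Fin n) → Matrix (Fin n) (Fin n) ℝ)
    (u : EuclideanSpace ℝ (Fin n) → ℝ) (U : Set (EuclideanSpace ℝ (Fin n))) : Prop where
  metric : IsMetricOn G U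
  smooth_factor : ContDiffOn ℝ ∞ u U
  eq_smul : ∀ z ∈ U, G' z = Real.exp (2 * u z) • G z

namespace IsConformalOn

variable {G G' : EuclideanSpace ℝ (Fin n) → Matrix (Fin n) (Fin n) ℝ}
  {u : EuclideanSpace ℝ (Fin n) → ℝ} {U : Set (EuclideanSpace ℝ (Fin n))}
  {y : EuclideanSpace ℝ (Fin n)}

theorem apply_eq (h : IsConformalOn G G' u U) (hy : y ∈ U) (i j : Fin n) :
    G' y i j = Real.exp (2 * u y) * G y i j := by
  rw [h.eq_smul y hy, Matrix.smul_apply, smul_eq_mul]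

theorem exp_mul_exp_neg (t : ℝ) : Real.exp t * Real.exp (-t) = 1 := by
  rw [← Real.exp_add]
  simp

theorem inv_apply_eq (h : IsConformalOn G G' u U) (hy : y ∈ U) (i j : Fin n) :
    (G' y)⁻¹ i j = Real.exp (-(2 * u y)) * (G y)⁻¹ i j := by
  have : (G' y)⁻¹ = Real.exp (-(2 * u y)) • (G y)⁻¹ := by
    refine Matrix.inv_eq_left_inv ?_
    rw [h.eq_smul y hy, Matrix.smul_mul, Matrix.mul_smul, smul_smul,
      Matrix.nonsing_inv_mul _ (h.metric.isUnit_det hy), mul_comm, exp_mul_exp_neg, one_smul]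
  rw [this, Matrix.smul_apply, smul_eq_mul]

theorem pderiv_metric_eq (h : IsConformalOn G G' u U) (hy : y ∈ U) (i j k : Fin n) :
    pderiv i (fun z => G' z j k) y =
      Real.exp (2 * u y) * (pderiv i (fun z => G z j k) y + 2 * pderiv i u y * G y j k) := by
  have hu := h.smooth_factor.differentiableAt_of_isOpen h.metric.isOpen hy
  rw [pderiv_congr h.metric.isOpen hy (fun z hz => h.apply_eq hz j k),
    pderiv_mul ((hu.const_mul 2).exp)
      ((h.metric.smooth j k).differentiableAt_of_isOpen h.metric.isOpen hy),
    pderiv_exp_mul 2 hu]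
  ring

theorem christoffel_eq (h : IsConformalOn G G' u U) (hy : y ∈ U) (k i j : Fin n) :
    christoffel G' y k i j = christoffel G y k i j + christoffelChange G u y k i j := by
  have hterm : ∀ l, (G' y)⁻¹ k l * (pderiv i (fun z => G' z j l) y
        + pderiv j (fun z => G' z i l) y - pderiv l (fun z => G' z i j) y) =
      (G y)⁻¹ k l * (pderiv i (fun z => G z j l) y
        + pderiv j (fun z => G z i l) y - pderiv l (fun z => G z i j) y)
      + 2 * (pderiv i u y * ((G y)⁻¹ k l * G y l j) + pderiv j u y * ((G y)⁻¹ k l * G y l i)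
        - G y i j * ((G y)⁻¹ k l * pderiv l u y)) := by
    intro l
    rw [h.inv_apply_eq hy, h.pderiv_metric_eq hy, h.pderiv_metric_eq hy, h.pderiv_metric_eq hy,
      h.metric.symm y hy l j, h.metric.symm y hy l i]
    linear_combination ((G y)⁻¹ k l * (pderiv i (fun z => G z j l) y
        + pderiv j (fun z => G z i l) y - pderiv l (fun z => G z i j) y)
      + 2 * (pderiv i u y * ((G y)⁻¹ k l * G y j l) + pderiv j u y * ((G y)⁻¹ k l * G y i l)
        - G y i j * ((G y)⁻¹ k l * pderiv l u y))) * exp_mul_exp_neg (2 * u y)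
  simp only [christoffel, hterm]
  rw [Finset.sum_add_distrib, ← Finset.mul_sum, Finset.sum_sub_distrib, Finset.sum_add_distrib,
    ← Finset.mul_sum, ← Finset.mul_sum, ← Finset.mul_sum, h.metric.sum_inv_mul hy,
    h.metric.sum_inv_mul hy, christoffelChange, grad]
  split_ifs <;> ring

theorem pderiv_christoffelChange (h : IsConformalOn G G' u U) (hy : y ∈ U) (i k j l : Fin n) :
    pderiv i (fun z => christoffelChange G u z k j l) y =
      (if k = j then pderiv i (pderiv l u) y else 0)
        + (if k = l then pderiv i (pderiv j u) y else 0)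
        - ((christoffelLow G y l i j + christoffelLow G y j i l) * grad G u y k
          + G y j l * pderiv i (fun z => grad G u z k) y) := by
  have hU := h.metric.isOpen
  have hp : ∀ a (c : Prop) [Decidable c], ContDiffOn ℝ ∞ (fun z => if c then pderiv a u z else 0) U
      ∧ pderiv i (fun z => if c then pderiv a u z else 0) y
        = if c then pderiv i (pderiv a u) y else 0 := by
    intro a c _
    split_ifs
    · exact ⟨contDiffOn_pderiv hU h.smooth_factor a, rfl⟩
    · exact ⟨contDiffOn_const, pderiv_const 0 i⟩
  have hg := (h.metric.smooth j l).differentiableAt_of_isOpen hU hy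
  have hv := (h.metric.smooth_grad h.smooth_factor k).differentiableAt_of_isOpen hU hy
  have h1 := (hp l (k = j)).1.differentiableAt_of_isOpen hU hy
  have h2 := (hp j (k = l)).1.differentiableAt_of_isOpen hU hy
  unfold christoffelChange
  rw [pderiv_sub (h1.fun_add h2) (hg.fun_mul hv), pderiv_add h1 h2, pderiv_mul hg hv,
    (hp l (k = j)).2, (hp j (k = l)).2, h.metric.pderiv_metric hy]

theorem smooth_christoffelChange (h : IsConformalOn G G' u U) (k j l : Fin n) :
    ContDiffOn ℝ ∞ (fun z => christoffelChange G u z k j l) U := by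
  have hp : ∀ a (c : Prop) [Decidable c],
      ContDiffOn ℝ ∞ (fun z => if c then pderiv a u z else 0) U := by
    intro a c _
    split_ifs
    · exact contDiffOn_pderiv h.metric.isOpen h.smooth_factor a
    · exact contDiffOn_const
  exact ((hp l (k = j)).add (hp j (k = l))).sub
    ((h.metric.smooth j l).mul (h.metric.smooth_grad h.smooth_factor k))

theorem sum_christoffel_mul_eq (h : IsConformalOn G G' u U) (hy : y ∈ U) (i j k l : Fin n) :
    ∑ s, christoffel G' y k i s * christoffel G' y s j l =
      ∑ s, christoffel G y k i s * christoffel G y s j l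
      + (christoffel G y k i j * pderiv l u y + christoffel G y k i l * pderiv j u y
        - G y j l * ∑ s, christoffel G y k i s * grad G u y s)
      + ((if k = i then ∑ s, pderiv s u y * christoffel G y s j l
          + (2 * pderiv j u y * pderiv l u y - G y j l * gradSq G u y) else 0)
        + pderiv i u y * (christoffel G y k j l + christoffelChange G u y k j l)
        - grad G u y k * (christoffelLow G y i j l
          + (G y i j * pderiv l u y + G y i l * pderiv j u y - G y j l * pderiv i u y))) := by
  simp only [h.christoffel_eq hy, add_mul, Finset.sum_add_distrib]
  rw [sum_christoffelChange_mul]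
  simp only [mul_add, Finset.sum_add_distrib]
  rw [sum_mul_christoffelChange, sum_mul_christoffelChange, sum_mul_christoffelChange,
    h.metric.lower_grad hy]
  simp only [christoffelLow, gradSq]
  split_ifs <;> ring

/-- `R̂_{ij}{}^k{}_l = R_{ij}{}^k{}_l - δ_i^k A_{jl} + δ_j^k A_{il} - g_{jl} A_i{}^k
+ g_{il} A_j{}^k`. -/
theorem riemannUp_eq (h : IsConformalOn G G' u U) (hy : y ∈ U) (i j k l : Fin n) :
    riemannUp G' y i j k l = riemannUp G y i j k l
      - ((if k = i then schoutenChange G u y j l else 0)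
        - (if k = j then schoutenChange G u y i l else 0)
        + G y j l * ∑ s, (G y)⁻¹ k s * schoutenChange G u y i s
        - G y i l * ∑ s, (G y)⁻¹ k s * schoutenChange G u y j s) := by
  have hd : ∀ a b c, pderiv a (fun z => christoffel G' z k b c) y =
      pderiv a (fun z => christoffel G z k b c) y
        + pderiv a (fun z => christoffelChange G u z k b c) y := by
    intro a b c
    rw [pderiv_congr h.metric.isOpen hy (fun z hz => h.christoffel_eq hz k b c),
      pderiv_add ((h.metric.smooth_christoffel k b c).differentiableAt_of_isOpen
        h.metric.isOpen hy)
      ((h.smooth_christoffelChange k b c).differentiableAt_of_isOpen h.metric.isOpen hy)]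
  simp only [riemannUp, Finset.sum_sub_distrib, h.sum_christoffel_mul_eq hy, hd,
    h.pderiv_christoffelChange hy, h.metric.raise_schoutenChange h.smooth_factor hy]
  simp only [schoutenChange, hess, covGrad, christoffelChange]
  rw [pderiv_comm h.metric.isOpen h.smooth_factor hy j i, h.metric.symm y hy j i,
    h.metric.christoffelLow_symm hy l j i, h.metric.christoffel_symm hy k j i]
  split_ifs <;> ring

theorem sum_metric_mul_raise (h : IsConformalOn G G' u U) (hy : y ∈ U) (i l : Fin n) :
    ∑ k, G y l k * ∑ s, (G y)⁻¹ k s * schoutenChange G u y i s = schoutenChange G u y i l :=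
  h.metric.lower_raise hy _ l

theorem riemann_eq (h : IsConformalOn G G' u U) (hy : y ∈ U) (i j k l : Fin n) :
    riemann G' y i j k l = Real.exp (2 * u y) * (riemann G y i j k l
      - (G y i k * schoutenChange G u y j l - G y j k * schoutenChange G u y i l
        + G y j l * schoutenChange G u y i k - G y i l * schoutenChange G u y j k)) := by
  simp only [riemann, h.riemannUp_eq hy, h.apply_eq hy, mul_assoc]
  rw [← Finset.mul_sum]
  congr 1
  simp only [mul_add, mul_sub, Finset.sum_add_distrib, Finset.sum_sub_distrib, mul_ite, mul_zero,
    Finset.sum_ite_eq', Finset.mem_univ, if_true]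
  simp_rw [mul_left_comm (G y k _), ← Finset.mul_sum, h.sum_metric_mul_raise hy]
  rw [h.metric.symm y hy k i, h.metric.symm y hy k j]

theorem ricci_eq (h : IsConformalOn G G' u U) (hy : y ∈ U) (i j : Fin n) :
    ricci G' y i j = ricci G y i j - ((n : ℝ) - 2) * schoutenChange G u y i j
      - G y i j * ∑ a, ∑ b, (G y)⁻¹ a b * schoutenChange G u y a b := by
  simp only [ricci, h.riemannUp_eq hy, Finset.sum_add_distrib, Finset.sum_sub_distrib, if_true,
    Finset.sum_const, Finset.card_univ, Fintype.card_fin, nsmul_eq_mul,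
    Finset.sum_ite_eq', Finset.mem_univ, ← Finset.mul_sum]
  simp_rw [h.metric.symm y hy _ j, h.sum_metric_mul_raise hy]
  ring

theorem scalarCurv_eq (h : IsConformalOn G G' u U) (hy : y ∈ U) :
    scalarCurv G' y = Real.exp (-(2 * u y)) * (scalarCurv G y
      - 2 * ((n : ℝ) - 1) * ∑ a, ∑ b, (G y)⁻¹ a b * schoutenChange G u y a b) := by
  simp only [scalarCurv, h.ricci_eq hy, h.inv_apply_eq hy, mul_assoc]
  simp_rw [← Finset.mul_sum]
  congr 1
  simp only [mul_sub, Finset.sum_sub_distrib]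
  set tr := ∑ a, ∑ b, (G y)⁻¹ a b * schoutenChange G u y a b with htr
  have h1 : ∑ i, ∑ j, (G y)⁻¹ i j * (((n : ℝ) - 2) * schoutenChange G u y i j) =
      ((n : ℝ) - 2) * tr := by
    simp_rw [mul_left_comm _ ((n : ℝ) - 2), ← Finset.mul_sum]
    rfl
  have h2 : ∑ i, ∑ j, (G y)⁻¹ i j * (G y i j * tr) = n * tr := by
    simp_rw [← mul_assoc, ← Finset.sum_mul]
    congr 1
    have h3 : ∀ i, ∑ j, (G y)⁻¹ i j * G y i j = 1 := by
      intro i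
      simp_rw [fun j => h.metric.symm y hy i j]
      rw [h.metric.sum_inv_mul hy, if_pos rfl]
    simp [h3]
  rw [h1, h2]
  ring

/-- `P̂_{ij} = P_{ij} - A_{ij}`. -/
theorem schouten_eq (h : IsConformalOn G G' u U) (hn : 2 < n) (hy : y ∈ U) (i j : Fin n) :
    schouten G' y i j = schouten G y i j - schoutenChange G u y i j := by
  have hn' : (2 : ℝ) < n := by exact_mod_cast hn
  have h1 : (n : ℝ) - 1 ≠ 0 := by linarith
  have h2 : (n : ℝ) - 2 ≠ 0 := by linarith
  simp only [schouten, h.ricci_eq hy, h.scalarCurv_eq hy, h.apply_eq hy]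
  set tr := ∑ a, ∑ b, (G y)⁻¹ a b * schoutenChange G u y a b
  have he := exp_mul_exp_neg (2 * u y)
  field_simp
  linear_combination (-(scalarCurv G y * G y i j) + 2 * ((n : ℝ) - 1) * tr * G y i j) * he

/-- The Weyl tensor `W_{ijkl}` has conformal weight `2`. -/
theorem weyl_eq (h : IsConformalOn G G' u U) (hy : y ∈ U) (i j k l : Fin n) :
    weyl G' y i j k l = Real.exp (2 * u y) * weyl G y i j k l := by
  unfold weyl
  split_ifs with hn
  · simp
  · simp only [h.riemann_eq hy, h.apply_eq hy, h.schouten_eq (not_le.1 hn) hy]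
    ring

end IsConformalOn

/-! ### Conformal change of the Cotton tensor -/

section

variable {G G' : EuclideanSpace ℝ (Fin n) → Matrix (Fin n) (Fin n) ℝ}
  {u : EuclideanSpace ℝ (Fin n) → ℝ} {U : Set (EuclideanSpace ℝ (Fin n))}
  {y : EuclideanSpace ℝ (Fin n)}

theorem IsMetricOn.cotton_eq (hG : IsMetricOn G U) (hy : y ∈ U) (i j k : Fin n) :
    cotton G y i j k = pderiv i (fun z => schouten G z j k) y
      - pderiv j (fun z => schouten G z i k) y
      - ∑ s, schouten G y j s * christoffel G y s i k
      + ∑ s, schouten G y i s * christoffel G y s j k := by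
  simp only [cotton, covSchouten, Finset.sum_add_distrib]
  simp_rw [hG.christoffel_symm hy _ j i, mul_comm (christoffel G y _ _ k)]
  ring

theorem IsMetricOn.pderiv_schoutenChange (hG : IsMetricOn G U) (hu : ContDiffOn ℝ ∞ u U)
    (hy : y ∈ U) (i j k : Fin n) :
    pderiv i (fun z => schoutenChange G u z j k) y =
      pderiv i (pderiv j (pderiv k u)) y
      - (∑ s, pderiv i (pderiv s u) y * christoffel G y s j k
        + ∑ s, pderiv s u y * pderiv i (fun z => christoffel G z s j k) y)
      - (pderiv i (pderiv j u) y * pderiv k u y + pderiv j u y * pderiv i (pderiv k u) y)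
      + ((∑ s, hess G u y i s * grad G u y s) * G y j k
        + (1 / 2) * gradSq G u y * (christoffelLow G y k i j + christoffelLow G y j i k)) := by
  have hU := hG.isOpen
  have hp : ∀ a, ContDiffOn ℝ ∞ (pderiv a u) U := contDiffOn_pderiv hU hu
  have hp' : ∀ a, DifferentiableAt ℝ (pderiv a u) y :=
    fun a => (hp a).differentiableAt_of_isOpen hU hy
  have hc : ∀ s, DifferentiableAt ℝ (fun z => christoffel G z s j k) y :=
    fun s => (hG.smooth_christoffel s j k).differentiableAt_of_isOpen hU hy
  have hpp := (contDiffOn_pderiv hU (hp k) j).differentiableAt_of_isOpen hU hy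
  have hq := (hG.smooth_gradSq hu).differentiableAt_of_isOpen hU hy
  have hg := (hG.smooth j k).differentiableAt_of_isOpen hU hy
  have hs : DifferentiableAt ℝ (fun z => ∑ s, pderiv s u z * christoffel G z s j k) y :=
    DifferentiableAt.fun_sum fun s _ => (hp' s).fun_mul (hc s)
  unfold schoutenChange hess
  rw [pderiv_add ((hpp.fun_sub hs).fun_sub ((hp' j).fun_mul (hp' k)))
      ((hq.const_mul (1 / 2)).fun_mul hg),
    pderiv_sub (hpp.fun_sub hs) ((hp' j).fun_mul (hp' k)), pderiv_sub hpp hs,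
    pderiv_sum_mul hp' hc, pderiv_mul (hp' j) (hp' k), pderiv_mul (hq.const_mul (1 / 2)) hg,
    pderiv_const_mul _ hq, hG.pderiv_gradSq hu hy, hG.pderiv_metric hy]
  simp only [hess]
  ring

theorem sum_schoutenChange_christoffel (i j k : Fin n) :
    ∑ s, schoutenChange G u y j s * christoffel G y s i k =
      ∑ s, pderiv j (pderiv s u) y * christoffel G y s i k
      - ∑ t, pderiv t u y * ∑ s, christoffel G y t j s * christoffel G y s i k
      - pderiv j u y * ∑ s, pderiv s u y * christoffel G y s i k
      + (1 / 2) * gradSq G u y * christoffelLow G y j i k := by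
  simp only [schoutenChange, hess, add_mul, sub_mul, Finset.sum_add_distrib,
    Finset.sum_sub_distrib, christoffelLow, Finset.mul_sum, Finset.sum_mul]
  congr 1
  · congr 1
    · congr 1
      rw [Finset.sum_comm]
      exact Finset.sum_congr rfl fun s _ => Finset.sum_congr rfl fun t _ => by ring
    · exact Finset.sum_congr rfl fun s _ => by ring
  · exact Finset.sum_congr rfl fun s _ => by ring

/-- The curl `∇_i A_{jk} - ∇_j A_{ik}` of the tensor `A`; the curvature comes from the commutator
of covariant derivatives applied to the differential of `u`. -/
theorem IsMetricOn.curl_schoutenChange (hG : IsMetricOn G U) (hu : ContDiffOn ℝ ∞ u U)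
    (hy : y ∈ U) (i j k : Fin n) :
    pderiv i (fun z => schoutenChange G u z j k) y - pderiv j (fun z => schoutenChange G u z i k) y
      - ∑ s, schoutenChange G u y j s * christoffel G y s i k
      + ∑ s, schoutenChange G u y i s * christoffel G y s j k =
    - ∑ t, pderiv t u y * riemannUp G y i j t k
      - pderiv j u y * hess G u y i k + pderiv i u y * hess G u y j k
      + G y j k * ∑ s, hess G u y i s * grad G u y s
      - G y i k * ∑ s, hess G u y j s * grad G u y s := by
  have hR : ∑ t, pderiv t u y * riemannUp G y i j t k =
      ∑ t, pderiv t u y * pderiv i (fun z => christoffel G z t j k) y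
      - ∑ t, pderiv t u y * pderiv j (fun z => christoffel G z t i k) y
      + (∑ t, pderiv t u y * ∑ s, christoffel G y t i s * christoffel G y s j k
        - ∑ t, pderiv t u y * ∑ s, christoffel G y t j s * christoffel G y s i k) := by
    simp only [riemannUp, mul_add, mul_sub, Finset.sum_add_distrib, Finset.sum_sub_distrib]
  have h3 := pderiv_comm hG.isOpen (contDiffOn_pderiv hG.isOpen hu k) hy j i
  have h2 := pderiv_comm hG.isOpen hu hy j i
  rw [hR, hG.pderiv_schoutenChange hu hy, hG.pderiv_schoutenChange hu hy,
    sum_schoutenChange_christoffel, sum_schoutenChange_christoffel, h3, h2,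
    hG.christoffelLow_symm hy k j i]
  have hB : ∀ a, hess G u y a k =
      pderiv a (pderiv k u) y - ∑ s, pderiv s u y * christoffel G y s a k := fun a => rfl
  rw [hB, hB]
  ring

theorem riemann_eq_weyl_add (hn : 2 < n) (i j k l : Fin n) :
    riemann G y i j k l = weyl G y i j k l
      + (G y i k * schouten G y j l - G y j k * schouten G y i l
        + G y j l * schouten G y i k - G y i l * schouten G y j k) := by
  rw [weyl, if_neg (not_le.2 hn)]
  ring

theorem IsMetricOn.sum_pderiv_mul_riemannUp (hG : IsMetricOn G U) (hn : 2 < n) (hy : y ∈ U)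
    (i j k : Fin n) :
    ∑ t, pderiv t u y * riemannUp G y i j t k =
      ∑ s, grad G u y s * weyl G y i j s k
      + (pderiv i u y * schouten G y j k - pderiv j u y * schouten G y i k
        + G y j k * ∑ s, schouten G y i s * grad G u y s
        - G y i k * ∑ s, schouten G y j s * grad G u y s) := by
  have h1 : ∑ t, pderiv t u y * riemannUp G y i j t k =
      ∑ s, grad G u y s * riemann G y i j s k := by
    simp_rw [← hG.lower_grad (u := u) hy, riemann, Finset.sum_mul, Finset.mul_sum]
    rw [Finset.sum_comm]
    refine Finset.sum_congr rfl fun s _ => Finset.sum_congr rfl fun t _ => ?_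
    rw [hG.symm y hy t s]
    ring
  rw [h1]
  simp only [riemann_eq_weyl_add hn, mul_add, mul_sub, Finset.sum_add_distrib,
    Finset.sum_sub_distrib, Finset.mul_sum]
  rw [← hG.lower_grad (u := u) hy i, ← hG.lower_grad (u := u) hy j, Finset.sum_mul,
    Finset.sum_mul]
  congr 1
  congr 1
  · congr 1
    · congr 1 <;> exact Finset.sum_congr rfl fun s _ => by ring
    · exact Finset.sum_congr rfl fun s _ => by ring
  · exact Finset.sum_congr rfl fun s _ => by ring

namespace IsConformalOn

theorem metric' (h : IsConformalOn G G' u U) : IsMetricOn G' U where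
  isOpen := h.metric.isOpen
  smooth i j := ((contDiffOn_const.mul h.smooth_factor).exp.mul (h.metric.smooth i j)).congr
    fun z hz => h.apply_eq hz i j
  symm z hz i j := by rw [h.apply_eq hz, h.apply_eq hz, h.metric.symm z hz]
  det_ne_zero z hz := by
    rw [h.eq_smul z hz, Matrix.det_smul]
    exact mul_ne_zero (pow_ne_zero _ (Real.exp_ne_zero _)) (h.metric.det_ne_zero z hz)

theorem smooth_schoutenChange (h : IsConformalOn G G' u U) (i j : Fin n) :
    ContDiffOn ℝ ∞ (fun z => schoutenChange G u z i j) U := by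
  have hp := contDiffOn_pderiv h.metric.isOpen h.smooth_factor
  exact (((contDiffOn_pderiv h.metric.isOpen (hp j) i).sub (ContDiffOn.sum fun s _ =>
    (hp s).mul (h.metric.smooth_christoffel s i j))).sub ((hp i).mul (hp j))).add
    ((contDiffOn_const.mul (h.metric.smooth_gradSq h.smooth_factor)).mul (h.metric.smooth i j))

theorem cotton_eq_of_two_lt (h : IsConformalOn G G' u U) (hn : 2 < n) (hy : y ∈ U)
    (i j k : Fin n) :
    cotton G' y i j k = cotton G y i j k + ∑ s, grad G u y s * weyl G y i j s k := by
  have hd : ∀ a b c, pderiv a (fun z => schouten G' z b c) y =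
      pderiv a (fun z => schouten G z b c) y
        - pderiv a (fun z => schoutenChange G u z b c) y := by
    intro a b c
    rw [pderiv_congr h.metric.isOpen hy (fun z hz => h.schouten_eq hn hz b c),
      pderiv_sub ((h.metric.smooth_schouten b c).differentiableAt_of_isOpen h.metric.isOpen hy)
      ((h.smooth_schoutenChange b c).differentiableAt_of_isOpen h.metric.isOpen hy)]
  have hs : ∀ a, ∑ s, schoutenChange G u y a s * grad G u y s =
      ∑ s, hess G u y a s * grad G u y s - (1 / 2) * gradSq G u y * pderiv a u y := by
    intro a
    rw [← h.metric.lower_grad (u := u) hy a]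
    simp only [schoutenChange, add_mul, sub_mul, Finset.sum_add_distrib, Finset.sum_sub_distrib,
      mul_assoc, ← Finset.mul_sum]
    rw [h.metric.lower_grad hy]
    simp only [gradSq]
    ring
  have hcurl := h.metric.curl_schoutenChange h.smooth_factor hy i j k
  rw [h.metric.sum_pderiv_mul_riemannUp hn hy] at hcurl
  rw [h.metric'.cotton_eq hy, h.metric.cotton_eq hy, hd, hd]
  simp only [h.christoffel_eq hy, mul_add, Finset.sum_add_distrib, sum_mul_christoffelChange]
  simp only [h.schouten_eq hn hy, sub_mul, Finset.sum_sub_distrib, hs i, hs j]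
  rw [h.metric.schouten_symm hy j i, h.metric.schoutenChange_symm h.smooth_factor hy j i]
  have hA : ∀ a, schoutenChange G u y a k = hess G u y a k - pderiv a u y * pderiv k u y
      + (1 / 2) * gradSq G u y * G y a k := fun a => rfl
  rw [hA i, hA j]
  linear_combination -hcurl

/-- `Ĉ_{ijk} = C_{ijk} + u^s W_{ijsk}`. -/
theorem cotton_eq (h : IsConformalOn G G' u U) (hn : 2 ≤ n) (hy : y ∈ U) (i j k : Fin n) :
    cotton G' y i j k = cotton G y i j k + ∑ s, grad G u y s * weyl G y i j s k := by
  rcases hn.lt_or_eq with hn' | hn'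
  · exact h.cotton_eq_of_two_lt hn' hy i j k
  · -- In dimension two the prefactor `1 / (n - 2)` is zero, so that both sides vanish.
    have h0 : ∀ (H : EuclideanSpace ℝ (Fin n) → Matrix (Fin n) (Fin n) ℝ) z a b,
        schouten H z a b = 0 := by
      intro H z a b
      simp [schouten, ← hn']
    simp [cotton, covSchouten, h0, pderiv_const, weyl, hn'.ge]

end IsConformalOn

end

/-! ### Conformal change of tensors with raised indices -/

section

variable {G G' : EuclideanSpace ℝ (Fin n) → Matrix (Fin n) (Fin n) ℝ}
  {u : EuclideanSpace ℝ (Fin n) → ℝ} {U : Set (EuclideanSpace ℝ (Fin n))}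
  {y : EuclideanSpace ℝ (Fin n)}

theorem IsMetricOn.smooth_weylUpUp (hG : IsMetricOn G U) (i j k l : Fin n) :
    ContDiffOn ℝ ∞ (fun z => weylUpUp G z i j k l) U :=
  ContDiffOn.sum fun p _ => ContDiffOn.sum fun q _ =>
    ((hG.smooth_inv k p).mul (hG.smooth_inv l q)).mul (hG.smooth_weyl i j p q)

theorem IsMetricOn.smooth_weylUp (hG : IsMetricOn G U) (i j k l : Fin n) :
    ContDiffOn ℝ ∞ (fun z => weylUp G z i j k l) U :=
  ContDiffOn.sum fun p _ => (hG.smooth_inv j p).mul (hG.smooth_weyl i p k l)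

theorem IsMetricOn.weylUpUp_antisymm_right (hG : IsMetricOn G U) (hy : y ∈ U) (i j k l : Fin n) :
    weylUpUp G y i j k l = -weylUpUp G y i j l k := by
  unfold weylUpUp
  rw [Finset.sum_comm]
  simp_rw [← Finset.sum_neg_distrib]
  refine Finset.sum_congr rfl fun p _ => Finset.sum_congr rfl fun q _ => ?_
  rw [hG.weyl_antisymm_right hy i j q p]
  ring

theorem IsMetricOn.weylUp_antisymm_right (hG : IsMetricOn G U) (hy : y ∈ U) (i j k l : Fin n) :
    weylUp G y i j k l = -weylUp G y i j l k := by
  unfold weylUp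
  simp_rw [← Finset.sum_neg_distrib]
  refine Finset.sum_congr rfl fun p _ => ?_
  rw [hG.weyl_antisymm_right hy i p k l]
  ring

namespace IsConformalOn

theorem weylUpUp_eq (h : IsConformalOn G G' u U) (hy : y ∈ U) (i j k l : Fin n) :
    weylUpUp G' y i j k l = Real.exp (-(2 * u y)) * weylUpUp G y i j k l := by
  unfold weylUpUp
  simp_rw [Finset.mul_sum]
  refine Finset.sum_congr rfl fun p _ => Finset.sum_congr rfl fun q _ => ?_
  rw [h.inv_apply_eq hy, h.inv_apply_eq hy, h.weyl_eq hy]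
  linear_combination (Real.exp (-(2 * u y)) * (G y)⁻¹ k p * (G y)⁻¹ l q * weyl G y i j p q) *
    exp_mul_exp_neg (2 * u y)

theorem weylUp_eq (h : IsConformalOn G G' u U) (hy : y ∈ U) (i j k l : Fin n) :
    weylUp G' y i j k l = weylUp G y i j k l := by
  unfold weylUp
  refine Finset.sum_congr rfl fun p _ => ?_
  rw [h.inv_apply_eq hy, h.weyl_eq hy]
  linear_combination ((G y)⁻¹ j p * weyl G y i p k l) * exp_mul_exp_neg (2 * u y)

theorem cottonUpThird_eq (h : IsConformalOn G G' u U) (hn : 2 ≤ n) (hy : y ∈ U) (i j k : Fin n) :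
    cottonUpThird G' y i j k = Real.exp (-(2 * u y)) *
      (cottonUpThird G y i j k + ∑ l, pderiv l u y * weylUpUp G y i j l k) := by
  have h1 : ∑ l, pderiv l u y * weylUpUp G y i j l k =
      ∑ p, (G y)⁻¹ k p * ∑ s, grad G u y s * weyl G y i j s p := by
    have h2 : ∑ p, (G y)⁻¹ k p * ∑ s, grad G u y s * weyl G y i j s p =
        ∑ s, grad G u y s * ∑ p, (G y)⁻¹ k p * weyl G y i j s p := by
      simp_rw [Finset.mul_sum]
      rw [Finset.sum_comm]
      exact Finset.sum_congr rfl fun p _ => Finset.sum_congr rfl fun q _ => by ring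
    have h3 : ∀ l, weylUpUp G y i j l k =
        ∑ s, (G y)⁻¹ l s * ∑ p, (G y)⁻¹ k p * weyl G y i j s p := by
      intro l
      simp only [weylUpUp, Finset.mul_sum, mul_assoc]
    rw [h2]
    simp_rw [h3, grad, Finset.sum_mul]
    refine (Finset.sum_congr rfl fun l _ => Finset.mul_sum _ _ _).trans ?_
    rw [Finset.sum_comm]
    refine Finset.sum_congr rfl fun p _ => Finset.sum_congr rfl fun q _ => ?_
    rw [h.metric.inv_symm hy q p]
    ring
  simp only [cottonUpThird, h.inv_apply_eq hy, h.cotton_eq hn hy, mul_assoc]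
  rw [← Finset.mul_sum, h1]
  simp only [mul_add, Finset.sum_add_distrib]

theorem cottonUpSecond_eq (h : IsConformalOn G G' u U) (hn : 2 ≤ n) (hy : y ∈ U)
    (i j k : Fin n) :
    cottonUpSecond G' y i j k = Real.exp (-(2 * u y)) *
      (cottonUpSecond G y i j k + ∑ l, grad G u y l * weylUp G y i j l k) := by
  have h1 : ∑ l, grad G u y l * weylUp G y i j l k =
      ∑ p, (G y)⁻¹ j p * ∑ s, grad G u y s * weyl G y i p s k := by
    simp_rw [weylUp, Finset.mul_sum]
    rw [Finset.sum_comm]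
    exact Finset.sum_congr rfl fun p _ => Finset.sum_congr rfl fun q _ => by ring
  simp only [cottonUpSecond, h.inv_apply_eq hy, h.cotton_eq hn hy, mul_assoc]
  rw [← Finset.mul_sum, h1]
  simp only [mul_add, Finset.sum_add_distrib]

end IsConformalOn

end

/-! ### Contractions of products over pairs -/

section Contractions

variable {k : ℕ}

/-- `∑_J ε^{j_1 … j_{2k}} w_{j_1 j_2}{}^{i_1 i_2} ⋯ w_{j_{2k-1} j_{2k}}{}^{i_{2k-1} i_{2k}}`. -/
noncomputable def pfaffianTensor (w : Fin (2 * k) → Fin (2 * k) → Fin (2 * k) → Fin (2 * k) → ℝ)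
    (I : Fin (2 * k) → Fin (2 * k)) : ℝ :=
  ∑ J : Fin (2 * k) → Fin (2 * k), leviCivita J *
    ∏ a : Fin k, w (J (fstPos a)) (J (sndPos a)) (I (fstPos a)) (I (sndPos a))

/-- `∑ Φ_{s_1 … s_k}^{t_1 … t_k} w_{t_1}{}^{s_1}{}_{i_1 i_2} ⋯
w_{t_k}{}^{s_k}{}_{i_{2k-1} i_{2k}}`. -/
noncomputable def invariantTensor (Φ : (Fin k → Fin (2 * k)) → (Fin k → Fin (2 * k)) → ℝ)
    (w : Fin (2 * k) → Fin (2 * k) → Fin (2 * k) → Fin (2 * k) → ℝ)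
    (I : Fin (2 * k) → Fin (2 * k)) : ℝ :=
  ∑ s : Fin k → Fin (2 * k), ∑ t : Fin k → Fin (2 * k),
    Φ s t * ∏ a : Fin k, w (t a) (s a) (I (fstPos a)) (I (sndPos a))

theorem prod_pairs_swap [NeZero k] (f : Fin k → Fin n → Fin n → ℝ)
    (hf : ∀ p q, f 0 p q = -f 0 q p) (I : Fin (2 * k) → Fin n) :
    ∏ a, f a (I (Equiv.swap (fstPos 0) (sndPos 0) (fstPos a)))
        (I (Equiv.swap (fstPos 0) (sndPos 0) (sndPos a))) =
      -∏ a, f a (I (fstPos a)) (I (sndPos a)) := by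
  rw [← Finset.mul_prod_erase Finset.univ _ (Finset.mem_univ (0 : Fin k)),
    ← Finset.mul_prod_erase Finset.univ (fun a => f a (I (fstPos a)) (I (sndPos a)))
      (Finset.mem_univ (0 : Fin k)), Equiv.swap_apply_left, Equiv.swap_apply_right, hf, neg_mul]
  congr 2
  refine Finset.prod_congr rfl fun a ha => ?_
  obtain ⟨h1, h2⟩ := swap_fstPos_sndPos_apply (Finset.ne_of_mem_erase ha)
  rw [h1, h2]

theorem prod_pairs_update [NeZero k] (f : Fin k → Fin n → Fin n → ℝ)
    (I : Fin (2 * k) → Fin n) (l : Fin n) :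
    ∏ a, f a (Function.update I (fstPos 0) l (fstPos a))
        (Function.update I (fstPos 0) l (sndPos a)) =
      f 0 l (I (sndPos 0)) *
        ∏ a ∈ Finset.univ.erase (0 : Fin k), f a (I (fstPos a)) (I (sndPos a)) := by
  rw [← Finset.mul_prod_erase Finset.univ _ (Finset.mem_univ (0 : Fin k)),
    Function.update_self, Function.update_of_ne (fstPos_ne_sndPos 0 0).symm]
  congr 1
  refine Finset.prod_congr rfl fun a ha => ?_
  rw [Function.update_of_ne (fstPos_injective.ne (Finset.ne_of_mem_erase ha)),
    Function.update_of_ne (fstPos_ne_sndPos 0 a).symm]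

theorem sign_swap_fstPos_sndPos [NeZero k] :
    Equiv.Perm.sign (Equiv.swap (fstPos (0 : Fin k)) (sndPos 0)) = -1 :=
  Equiv.Perm.sign_swap (fstPos_ne_sndPos 0 0)

variable {w : Fin (2 * k) → Fin (2 * k) → Fin (2 * k) → Fin (2 * k) → ℝ}

theorem altUnder_pfaffianTensor_swap [NeZero k] (hw : ∀ a b c d, w a b c d = -w a b d c) :
    AltUnder (pfaffianTensor w) (Equiv.swap (fstPos 0) (sndPos 0)) := by
  intro I
  rw [sign_swap_fstPos_sndPos]
  unfold pfaffianTensor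
  push_cast
  rw [neg_one_mul, ← Finset.sum_neg_distrib]
  refine Finset.sum_congr rfl fun J _ => ?_
  rw [prod_pairs_swap (fun a p q => w (J (fstPos a)) (J (sndPos a)) p q) (fun p q => hw _ _ _ _),
    mul_neg]

theorem altUnder_pfaffianTensor_pairSwap (a b : Fin k) :
    AltUnder (pfaffianTensor w) (pairSwap a b) := by
  intro I
  rw [sign_pairSwap]
  unfold pfaffianTensor
  push_cast
  rw [one_mul]
  -- Permuting the pairs of `J` in the same way does not change `ε^J`.
  refine (sum_comp_perm (pairSwap a b) _).symm.trans (Finset.sum_congr rfl fun J _ => ?_)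
  rw [leviCivita_comp_perm, sign_pairSwap]
  push_cast
  rw [one_mul]
  simp_rw [pairSwap_fstPos, pairSwap_sndPos]
  congr 1
  exact Equiv.prod_comp (Equiv.swap a b)
    fun c => w (J (fstPos c)) (J (sndPos c)) (I (fstPos c)) (I (sndPos c))

variable {Φ : (Fin k → Fin (2 * k)) → (Fin k → Fin (2 * k)) → ℝ}

theorem altUnder_invariantTensor_swap [NeZero k] (hw : ∀ a b c d, w a b c d = -w a b d c) :
    AltUnder (invariantTensor Φ w) (Equiv.swap (fstPos 0) (sndPos 0)) := by
  intro I
  rw [sign_swap_fstPos_sndPos]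
  unfold invariantTensor
  push_cast
  rw [neg_one_mul, ← Finset.sum_neg_distrib]
  refine Finset.sum_congr rfl fun s _ => ?_
  rw [← Finset.sum_neg_distrib]
  refine Finset.sum_congr rfl fun t _ => ?_
  rw [prod_pairs_swap (fun a p q => w (t a) (s a) p q) (fun p q => hw _ _ _ _), mul_neg]

theorem altUnder_invariantTensor_pairSwap (hΦ : IsInvariantPolynomial (2 * k) k Φ)
    (a b : Fin k) : AltUnder (invariantTensor Φ w) (pairSwap a b) := by
  intro I
  rw [sign_pairSwap]
  unfold invariantTensor
  push_cast
  rw [one_mul]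
  -- Permuting the indices `s` and `t` in the same way does not change `Φ`.
  refine (sum_comp_perm (Equiv.swap a b) _).symm.trans (Finset.sum_congr rfl fun s _ => ?_)
  refine (sum_comp_perm (Equiv.swap a b) _).symm.trans (Finset.sum_congr rfl fun t _ => ?_)
  rw [hΦ.2 (Equiv.swap a b) s t]
  simp_rw [pairSwap_fstPos, pairSwap_sndPos]
  congr 1
  exact Equiv.prod_comp (Equiv.swap a b)
    fun c => w (t c) (s c) (I (fstPos c)) (I (sndPos c))

end Contractions

/-! ### Densities of conformal weight `-2k` -/

variable {k : ℕ}
  {G G' : EuclideanSpace ℝ (Fin (2 * k)) → Matrix (Fin (2 * k)) (Fin (2 * k)) ℝ}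
  {u : EuclideanSpace ℝ (Fin (2 * k)) → ℝ} {U : Set (EuclideanSpace ℝ (Fin (2 * k)))}
  {y : EuclideanSpace ℝ (Fin (2 * k))}

theorem exp_neg_two_mul_pow (t : ℝ) : Real.exp (-(2 * t)) ^ k = Real.exp (-(2 * k) * t) := by
  rw [← Real.exp_nat_mul]
  congr 1
  ring

theorem mul_pow_card_erase [NeZero k] (c : ℝ) :
    c * c ^ (Finset.univ.erase (0 : Fin k)).card = c ^ k := by
  rw [Finset.card_erase_of_mem (Finset.mem_univ _), Finset.card_univ, Fintype.card_fin,
    ← pow_succ', Nat.sub_add_cancel (Nat.one_le_iff_ne_zero.2 (NeZero.ne k))]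

theorem two_le_two_mul [NeZero k] : 2 ≤ 2 * k := by
  have := Nat.one_le_iff_ne_zero.2 (NeZero.ne k)
  omega

/-- The derivative of a density of conformal weight `-2k`. -/
theorem IsConformalOn.pderiv_of_weight (h : IsConformalOn G G' u U) (hy : y ∈ U)
    {F F' : EuclideanSpace ℝ (Fin (2 * k)) → ℝ} (hF : ContDiffOn ℝ ∞ F U)
    (hFF' : ∀ z ∈ U, F' z = Real.exp (-(2 * k) * u z) * F z) (i : Fin (2 * k)) :
    pderiv i F' y =
      Real.exp (-(2 * k) * u y) * (pderiv i F y - 2 * k * pderiv i u y * F y) := by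
  have hu := h.smooth_factor.differentiableAt_of_isOpen h.metric.isOpen hy
  rw [pderiv_congr h.metric.isOpen hy hFF', pderiv_mul (hu.const_mul _).exp
    (hF.differentiableAt_of_isOpen h.metric.isOpen hy), pderiv_exp_mul _ hu]
  ring

/-! ### Conformal change of the Weyl Pfaffian and of `ξ` -/

theorem pfaffianWeyl_eq_sum (z : EuclideanSpace ℝ (Fin (2 * k))) :
    pfaffianWeyl k G z = (1 / (k.factorial : ℝ)) *
      ∑ I, leviCivita I * pfaffianTensor (weylUpUp G z) I := by
  unfold pfaffianWeyl pfaffianTensor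
  simp_rw [genDelta_eq_mul, mul_assoc, Finset.mul_sum]

theorem IsMetricOn.smooth_pfaffianWeyl (hG : IsMetricOn G U) :
    ContDiffOn ℝ ∞ (pfaffianWeyl k G) U :=
  contDiffOn_const.mul (ContDiffOn.sum fun _ _ => ContDiffOn.sum fun _ _ =>
    contDiffOn_const.mul (contDiffOn_prod fun _ _ => hG.smooth_weylUpUp _ _ _ _))

/-- The algebraic identity behind the invariance of `ξ`:
`δ_{i i_2 …}^{j j_2 …} W_{j j_2}{}^{l i_2} W_{j_3 j_4}{}^{i_3 i_4} ⋯ = (k! / n) δ_i^l Pf(W)`,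
contracted with `x_l`. -/
theorem IsMetricOn.sum_genDelta_weyl [NeZero k] (hG : IsMetricOn G U) (hy : y ∈ U)
    (x : Fin (2 * k) → ℝ) (i : Fin (2 * k)) :
    2 * (k : ℝ) * ∑ I : Fin (2 * k) → Fin (2 * k), ∑ J : Fin (2 * k) → Fin (2 * k),
      (if I (fstPos 0) = i then
        genDelta I J * (∑ l, x l * weylUpUp G y (J (fstPos 0)) (J (sndPos 0)) l (I (sndPos 0))) *
          ∏ a ∈ Finset.univ.erase (0 : Fin k),
            weylUpUp G y (J (fstPos a)) (J (sndPos a)) (I (fstPos a)) (I (sndPos a))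
      else 0) = x i * ((k.factorial : ℝ) * pfaffianWeyl k G y) := by
  have hw : ∀ a b c d, weylUpUp G y a b c d = -weylUpUp G y a b d c :=
    fun a b c d => hG.weylUpUp_antisymm_right hy a b c d
  have hrow : ∀ I : Fin (2 * k) → Fin (2 * k), ∑ J : Fin (2 * k) → Fin (2 * k),
      (if I (fstPos 0) = i then
        genDelta I J * (∑ l, x l * weylUpUp G y (J (fstPos 0)) (J (sndPos 0)) l (I (sndPos 0))) *
          ∏ a ∈ Finset.univ.erase (0 : Fin k),
            weylUpUp G y (J (fstPos a)) (J (sndPos a)) (I (fstPos a)) (I (sndPos a))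
      else 0) = ∑ l, x l * (if I (fstPos 0) = i then
        leviCivita I * pfaffianTensor (weylUpUp G y) (Function.update I (fstPos 0) l)
      else 0) := by
    intro I
    split_ifs
    · simp only [pfaffianTensor, genDelta_eq_mul]
      simp_rw [fun (J : Fin (2 * k) → Fin (2 * k)) l => prod_pairs_update
        (fun a p q => weylUpUp G y (J (fstPos a)) (J (sndPos a)) p q) I l]
      simp_rw [Finset.mul_sum, Finset.sum_mul]
      rw [Finset.sum_comm]
      exact Finset.sum_congr rfl fun l _ => Finset.sum_congr rfl fun J _ => by ring
    · simp
  rw [Finset.sum_congr rfl fun I _ => hrow I, Finset.sum_comm, Finset.mul_sum]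
  have hl : ∀ l, 2 * (k : ℝ) * ∑ I : Fin (2 * k) → Fin (2 * k), x l * (if I (fstPos 0) = i then
      leviCivita I * pfaffianTensor (weylUpUp G y) (Function.update I (fstPos 0) l) else 0) =
      x l * if i = l then ∑ I, leviCivita I * pfaffianTensor (weylUpUp G y) I else 0 := by
    intro l
    rw [← Finset.mul_sum, mul_left_comm, contraction_first_slot _
      (altUnder_pfaffianTensor_swap hw) (altUnder_pfaffianTensor_pairSwap 0)]
  rw [Finset.sum_congr rfl fun l _ => hl l]
  rw [pfaffianWeyl_eq_sum, ← mul_assoc (k.factorial : ℝ), mul_one_div_cancel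
    (Nat.cast_ne_zero.2 k.factorial_ne_zero), one_mul]
  simp

namespace IsConformalOn

theorem pfaffianWeyl_eq (h : IsConformalOn G G' u U) (hy : y ∈ U) :
    pfaffianWeyl k G' y = Real.exp (-(2 * k) * u y) * pfaffianWeyl k G y := by
  unfold pfaffianWeyl
  simp_rw [h.weylUpUp_eq hy, Finset.prod_mul_distrib, Finset.prod_const, Finset.card_univ,
    Fintype.card_fin, exp_neg_two_mul_pow, mul_left_comm _ (Real.exp (-(2 * k) * u y)),
    ← Finset.mul_sum]
  ring

theorem xi_eq [NeZero k] (h : IsConformalOn G G' u U) (hy : y ∈ U) (i : Fin (2 * k)) :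
    Real.exp (2 * k * u y) * xi k G' y i = xi k G y i := by
  have hk : (k : ℝ) ≠ 0 := Nat.cast_ne_zero.2 (NeZero.ne k)
  have hf : (k.factorial : ℝ) ≠ 0 := Nat.cast_ne_zero.2 k.factorial_ne_zero
  have hterm : ∀ I J : Fin (2 * k) → Fin (2 * k), (if I (fstPos 0) = i then
        genDelta I J * cottonUpThird G' y (J (fstPos 0)) (J (sndPos 0)) (I (sndPos 0)) *
          ∏ a ∈ Finset.univ.erase (0 : Fin k),
            weylUpUp G' y (J (fstPos a)) (J (sndPos a)) (I (fstPos a)) (I (sndPos a)) else 0) =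
      Real.exp (-(2 * k) * u y) * (if I (fstPos 0) = i then
        genDelta I J * cottonUpThird G y (J (fstPos 0)) (J (sndPos 0)) (I (sndPos 0)) *
          ∏ a ∈ Finset.univ.erase (0 : Fin k),
            weylUpUp G y (J (fstPos a)) (J (sndPos a)) (I (fstPos a)) (I (sndPos a)) else 0)
      + Real.exp (-(2 * k) * u y) * (if I (fstPos 0) = i then
        genDelta I J * (∑ l, pderiv l u y *
            weylUpUp G y (J (fstPos 0)) (J (sndPos 0)) l (I (sndPos 0))) *
          ∏ a ∈ Finset.univ.erase (0 : Fin k),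
            weylUpUp G y (J (fstPos a)) (J (sndPos a)) (I (fstPos a)) (I (sndPos a)) else 0) := by
    intro I J
    split_ifs
    · simp_rw [h.weylUpUp_eq hy, Finset.prod_mul_distrib, Finset.prod_const,
        h.cottonUpThird_eq two_le_two_mul hy]
      rw [← exp_neg_two_mul_pow, ← mul_pow_card_erase (k := k)]
      ring
    · simp
  have hvar := h.metric.sum_genDelta_weyl hy (fun l => pderiv l u y) i
  have hexp : Real.exp (2 * k * u y) * Real.exp (-(2 * k) * u y) = 1 := by
    rw [neg_mul]
    exact exp_mul_exp_neg _
  unfold xi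
  simp_rw [hterm, Finset.sum_add_distrib, ← Finset.mul_sum]
  rw [h.pderiv_of_weight hy h.metric.smooth_pfaffianWeyl (fun z hz => h.pfaffianWeyl_eq hz)]
  generalize (∑ I : Fin (2 * k) → Fin (2 * k), ∑ J : Fin (2 * k) → Fin (2 * k),
    if I (fstPos 0) = i then
      genDelta I J * (∑ l, pderiv l u y *
          weylUpUp G y (J (fstPos 0)) (J (sndPos 0)) l (I (sndPos 0))) *
        ∏ a ∈ Finset.univ.erase (0 : Fin k),
          weylUpUp G y (J (fstPos a)) (J (sndPos a)) (I (fstPos a)) (I (sndPos a)) else 0) = S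
    at hvar ⊢
  generalize (∑ I : Fin (2 * k) → Fin (2 * k), ∑ J : Fin (2 * k) → Fin (2 * k),
    if I (fstPos 0) = i then
      genDelta I J * cottonUpThird G y (J (fstPos 0)) (J (sndPos 0)) (I (sndPos 0)) *
        ∏ a ∈ Finset.univ.erase (0 : Fin k),
          weylUpUp G y (J (fstPos a)) (J (sndPos a)) (I (fstPos a)) (I (sndPos a)) else 0) = T
  have hS : S = pderiv i u y * (k.factorial * pfaffianWeyl k G y) / (2 * k) := by
    rw [eq_div_iff (by simpa using hk), ← hvar]
    ring
  rw [hS]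
  push_cast
  generalize Real.exp (2 * k * u y) = e at hexp ⊢
  generalize Real.exp (-(2 * k) * u y) = e' at hexp ⊢
  generalize pfaffianWeyl k G y = pf
  generalize pderiv i (pfaffianWeyl k G) y = dpf
  generalize pderiv i u y = du
  have : e * (1 / (k.factorial : ℝ) * (e' * T + e' * (du * (k.factorial * pf) / (2 * k)))
      + 1 / (2 * (2 * (k : ℝ)) * k) * (e' * (dpf - 2 * k * du * pf))) =
      (e * e') * (1 / (k.factorial : ℝ) * T + 1 / (2 * (2 * (k : ℝ)) * k) * dpf) := by
    field_simp
    ring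
  rw [this, hexp, one_mul]

end IsConformalOn

variable {Φ : (Fin k → Fin (2 * k)) → (Fin k → Fin (2 * k)) → ℝ}

/-! ### Conformal change of the Pontrjagin-type densities and of `ρ` -/

/-- The factor `√|det g| det (g^{ij})` relating `ε^{i_1 … i_n}` to the Levi-Civita symbol. -/
noncomputable def raisedDensity {n : ℕ} (G : EuclideanSpace ℝ (Fin n) → Matrix (Fin n) (Fin n) ℝ)
    (y : EuclideanSpace ℝ (Fin n)) : ℝ :=
  √|(G y).det| * ((G y)⁻¹).det

/-- The components `ε_i{}^{i_2 … i_n}` of the volume form with all indices but the first raised;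
the tuple `I` is `(*, i_2, …, i_n)`. -/
noncomputable def raisedVolForm [NeZero k]
    (G : EuclideanSpace ℝ (Fin (2 * k)) → Matrix (Fin (2 * k)) (Fin (2 * k)) ℝ)
    (y : EuclideanSpace ℝ (Fin (2 * k))) (i : Fin (2 * k)) (I : Fin (2 * k) → Fin (2 * k)) : ℝ :=
  ∑ L : Fin (2 * k) → Fin (2 * k), (if L (fstPos 0) = i then
    volForm G y L * ∏ b ∈ Finset.univ.erase (fstPos 0), (G y)⁻¹ (L b) (I b) else 0)

theorem sum_volForm_mul_prod_inv {n : ℕ}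
    {G : EuclideanSpace ℝ (Fin n) → Matrix (Fin n) (Fin n) ℝ} {y : EuclideanSpace ℝ (Fin n)}
    (I : Fin n → Fin n) :
    ∑ L : Fin n → Fin n, volForm G y L * ∏ b, (G y)⁻¹ (L b) (I b) =
      raisedDensity G y * leviCivita I := by
  simp_rw [volForm, genDelta_id, mul_assoc, ← Finset.mul_sum, sum_leviCivita_mul_prod,
    raisedDensity, mul_assoc]

theorem IsMetricOn.raisedVolForm_eq [NeZero k] (hG : IsMetricOn G U) (hy : y ∈ U)
    (i : Fin (2 * k)) (I : Fin (2 * k) → Fin (2 * k)) :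
    raisedVolForm G y i I = raisedDensity G y *
      ∑ j, G y i j * leviCivita (Function.update I (fstPos 0) j) := by
  have h : ∀ j, raisedDensity G y * (G y i j * leviCivita (Function.update I (fstPos 0) j)) =
      ∑ L : Fin (2 * k) → Fin (2 * k), volForm G y L * (((G y)⁻¹ (L (fstPos 0)) j * G y j i) *
        ∏ b ∈ Finset.univ.erase (fstPos 0), (G y)⁻¹ (L b) (I b)) := by
    intro j
    rw [mul_left_comm, ← sum_volForm_mul_prod_inv, Finset.mul_sum]
    refine Finset.sum_congr rfl fun L _ => ?_
    rw [← Finset.mul_prod_erase Finset.univ _ (Finset.mem_univ (fstPos (0 : Fin k))),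
      Function.update_self, hG.symm y hy i j]
    have : ∏ b ∈ Finset.univ.erase (fstPos (0 : Fin k)),
          (G y)⁻¹ (L b) (Function.update I (fstPos 0) j b) =
        ∏ b ∈ Finset.univ.erase (fstPos (0 : Fin k)), (G y)⁻¹ (L b) (I b) :=
      Finset.prod_congr rfl fun b hb => by
        rw [Function.update_of_ne (Finset.ne_of_mem_erase hb)]
    rw [this]
    ring
  rw [Finset.mul_sum, Finset.sum_congr rfl fun j _ => h j, Finset.sum_comm]
  refine Finset.sum_congr rfl fun L _ => ?_
  rw [← Finset.mul_sum, ← Finset.sum_mul, hG.sum_inv_mul hy]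
  split_ifs <;> simp

theorem pontrjaginWeyl_eq_sum (z : EuclideanSpace ℝ (Fin (2 * k))) :
    pontrjaginWeyl k Φ G z = (1 / ((2 * k).factorial : ℝ)) *
      (raisedDensity G z * ∑ I, leviCivita I * invariantTensor Φ (weylUp G z) I) := by
  unfold pontrjaginWeyl
  simp_rw [sum_volForm_mul_prod_inv, mul_assoc, ← Finset.mul_sum]
  rfl

theorem IsMetricOn.smooth_pontrjaginWeyl (hG : IsMetricOn G U) :
    ContDiffOn ℝ ∞ (pontrjaginWeyl k Φ G) U := by
  have hd := contDiffOn_det hG.smooth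
  refine ContDiffOn.congr ?_ fun z _ => pontrjaginWeyl_eq_sum z
  refine contDiffOn_const.mul (ContDiffOn.mul ?_ (ContDiffOn.sum fun _ _ =>
    contDiffOn_const.mul (ContDiffOn.sum fun _ _ => ContDiffOn.sum fun _ _ =>
      contDiffOn_const.mul (contDiffOn_prod fun _ _ => hG.smooth_weylUp _ _ _ _))))
  exact ((hd.abs hG.det_ne_zero).sqrt fun z hz => abs_ne_zero.2 (hG.det_ne_zero z hz)).mul
    (contDiffOn_det hG.smooth_inv)

/-- The algebraic identity behind the invariance of `ρ`:
`ε_i{}^{i_2 …} Φ W_{t_1}{}^{s_1 l}{}_{i_2} W_{t_2}{}^{s_2}{}_{i_3 i_4} ⋯ = ((2k)! / n) δ_i^l p_Φ(W)`,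
contracted with the gradient of `u`. -/
theorem IsMetricOn.sum_raisedVolForm_weyl [NeZero k] (hG : IsMetricOn G U) (hy : y ∈ U)
    (hΦ : IsInvariantPolynomial (2 * k) k Φ) (i : Fin (2 * k)) :
    2 * (k : ℝ) * ∑ I : Fin (2 * k) → Fin (2 * k), (if I (fstPos 0) = i then
        raisedVolForm G y i I * ∑ s : Fin k → Fin (2 * k), ∑ t : Fin k → Fin (2 * k),
          Φ s t * (∑ l, grad G u y l * weylUp G y (t 0) (s 0) l (I (sndPos 0))) *
            ∏ a ∈ Finset.univ.erase (0 : Fin k),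
              weylUp G y (t a) (s a) (I (fstPos a)) (I (sndPos a)) else 0) =
      pderiv i u y * (((2 * k).factorial : ℝ) * pontrjaginWeyl k Φ G y) := by
  have hw : ∀ a b c d, weylUp G y a b c d = -weylUp G y a b d c :=
    fun a b c d => hG.weylUp_antisymm_right hy a b c d
  set X := invariantTensor Φ (weylUp G y) with hX
  have hinner : ∀ I : Fin (2 * k) → Fin (2 * k),
      ∑ s : Fin k → Fin (2 * k), ∑ t : Fin k → Fin (2 * k),
        Φ s t * (∑ l, grad G u y l * weylUp G y (t 0) (s 0) l (I (sndPos 0))) *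
          ∏ a ∈ Finset.univ.erase (0 : Fin k),
            weylUp G y (t a) (s a) (I (fstPos a)) (I (sndPos a)) =
      ∑ l, grad G u y l * X (Function.update I (fstPos 0) l) := by
    intro I
    simp only [hX, invariantTensor]
    simp_rw [fun (s t : Fin k → Fin (2 * k)) l => prod_pairs_update
      (fun a p q => weylUp G y (t a) (s a) p q) I l]
    symm
    refine (Finset.sum_congr rfl fun l _ => Finset.mul_sum _ _ _).trans ?_
    rw [Finset.sum_comm]
    refine Finset.sum_congr rfl fun s _ => ?_
    refine (Finset.sum_congr rfl fun l _ => Finset.mul_sum _ _ _).trans ?_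
    rw [Finset.sum_comm]
    refine Finset.sum_congr rfl fun t _ => ?_
    rw [Finset.mul_sum, Finset.sum_mul]
    exact Finset.sum_congr rfl fun l _ => by ring
  -- The lowered slot of `ε` is exchanged for a raised one, at the cost of a factor `g_{ij}`.
  have hslot : ∀ j l, ∑ I : Fin (2 * k) → Fin (2 * k), (if I (fstPos 0) = i then
      leviCivita (Function.update I (fstPos 0) j) * X (Function.update I (fstPos 0) l) else 0) =
      ∑ I : Fin (2 * k) → Fin (2 * k), (if I (fstPos 0) = j then
        leviCivita I * X (Function.update I (fstPos 0) l) else 0) := by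
    intro j l
    have := sum_update_reindex (fstPos (0 : Fin k)) i j (fun _ => 1)
      (fun I => leviCivita I * X (Function.update I (fstPos 0) l))
    simpa only [one_mul, Function.update_idem] using this
  have hrow : ∀ I : Fin (2 * k) → Fin (2 * k), (if I (fstPos 0) = i then
        raisedVolForm G y i I * ∑ l, grad G u y l * X (Function.update I (fstPos 0) l) else 0) =
      ∑ j, ∑ l, raisedDensity G y * (G y i j * grad G u y l) * (if I (fstPos 0) = i then
        leviCivita (Function.update I (fstPos 0) j) * X (Function.update I (fstPos 0) l)
        else 0) := by
    intro I
    split_ifs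
    · rw [hG.raisedVolForm_eq hy, mul_assoc, Finset.sum_mul_sum, Finset.mul_sum]
      refine Finset.sum_congr rfl fun j _ => ?_
      rw [Finset.mul_sum]
      exact Finset.sum_congr rfl fun l _ => by ring
    · simp
  simp_rw [hinner, hrow]
  rw [Finset.sum_comm, Finset.mul_sum]
  have hj : ∀ j, 2 * (k : ℝ) * ∑ I : Fin (2 * k) → Fin (2 * k), ∑ l,
      raisedDensity G y * (G y i j * grad G u y l) * (if I (fstPos 0) = i then
        leviCivita (Function.update I (fstPos 0) j) * X (Function.update I (fstPos 0) l)
        else 0) =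
      G y i j * grad G u y j * (raisedDensity G y * ∑ I, leviCivita I * X I) := by
    intro j
    rw [Finset.sum_comm, Finset.mul_sum]
    have hl : ∀ l, 2 * (k : ℝ) * ∑ I : Fin (2 * k) → Fin (2 * k),
        raisedDensity G y * (G y i j * grad G u y l) * (if I (fstPos 0) = i then
          leviCivita (Function.update I (fstPos 0) j) * X (Function.update I (fstPos 0) l)
          else 0) =
        raisedDensity G y * (G y i j * grad G u y l) *
          if j = l then ∑ I, leviCivita I * X I else 0 := by
      intro l
      rw [← Finset.mul_sum, hslot, mul_left_comm, contraction_first_slot X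
        (altUnder_invariantTensor_swap hw) (altUnder_invariantTensor_pairSwap hΦ 0)]
    rw [Finset.sum_congr rfl fun l _ => hl l]
    simp only [mul_ite, mul_zero, Finset.sum_ite_eq, Finset.mem_univ, if_true]
    ring
  rw [Finset.sum_congr rfl fun j _ => hj j, ← Finset.sum_mul, hG.lower_grad hy,
    pontrjaginWeyl_eq_sum, ← mul_assoc ((2 * k).factorial : ℝ), mul_one_div_cancel
    (Nat.cast_ne_zero.2 (2 * k).factorial_ne_zero), one_mul]

namespace IsConformalOn

theorem raisedDensity_eq (h : IsConformalOn G G' u U) (hy : y ∈ U) :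
    raisedDensity G' y = Real.exp (-(2 * k) * u y) * raisedDensity G y := by
  have h1 : √|(G' y).det| = Real.exp (2 * u y) ^ k * √|(G y).det| := by
    rw [h.eq_smul y hy, Matrix.det_smul, abs_mul, Fintype.card_fin, abs_pow, Real.abs_exp,
      Real.sqrt_mul (by positivity), pow_mul', Real.sqrt_sq (by positivity)]
  have h2 : (G' y)⁻¹ = Real.exp (-(2 * u y)) • (G y)⁻¹ := by
    ext a b
    simp [h.inv_apply_eq hy]
  have h3 : Real.exp (2 * u y) ^ k * Real.exp (-(2 * u y)) ^ k = 1 := by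
    rw [← mul_pow, exp_mul_exp_neg, one_pow]
  rw [raisedDensity, raisedDensity, h1, h2, Matrix.det_smul, Fintype.card_fin, pow_mul',
    exp_neg_two_mul_pow]
  rw [exp_neg_two_mul_pow] at h3
  linear_combination (√|(G y).det| * Real.exp (-(2 * k) * u y) * ((G y)⁻¹).det) * h3

theorem pontrjaginWeyl_eq (h : IsConformalOn G G' u U) (hy : y ∈ U) :
    pontrjaginWeyl k Φ G' y = Real.exp (-(2 * k) * u y) * pontrjaginWeyl k Φ G y := by
  have hW : weylUp G' y = weylUp G y := by
    funext a b c d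
    exact h.weylUp_eq hy a b c d
  rw [pontrjaginWeyl_eq_sum, pontrjaginWeyl_eq_sum, hW, h.raisedDensity_eq hy]
  ring

theorem raisedVolForm_eq [NeZero k] (h : IsConformalOn G G' u U) (hy : y ∈ U) (i : Fin (2 * k))
    (I : Fin (2 * k) → Fin (2 * k)) :
    raisedVolForm G' y i I =
      Real.exp (2 * u y) * Real.exp (-(2 * k) * u y) * raisedVolForm G y i I := by
  rw [h.metric'.raisedVolForm_eq hy, h.metric.raisedVolForm_eq hy, h.raisedDensity_eq hy]
  simp_rw [h.apply_eq hy, mul_assoc, ← Finset.mul_sum]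
  ring

theorem rho_eq [NeZero k] (h : IsConformalOn G G' u U) (hy : y ∈ U)
    (hΦ : IsInvariantPolynomial (2 * k) k Φ) (i : Fin (2 * k)) :
    Real.exp (2 * k * u y) * rho k Φ G' y i = rho k Φ G y i := by
  have hk : (k : ℝ) ≠ 0 := Nat.cast_ne_zero.2 (NeZero.ne k)
  have hf : ((2 * k - 1).factorial : ℝ) ≠ 0 := Nat.cast_ne_zero.2 (2 * k - 1).factorial_ne_zero
  have hfac : ((2 * k).factorial : ℝ) = 2 * k * (2 * k - 1).factorial := by
    rw [← Nat.mul_factorial_pred (by have := NeZero.ne k; omega)]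
    push_cast
    ring
  -- The first summand of `ρ` as a function of the tensor that occupies the place of `C`.
  let first (H : EuclideanSpace ℝ (Fin (2 * k)) → Matrix (Fin (2 * k)) (Fin (2 * k)) ℝ)
      (c : Fin (2 * k) → Fin (2 * k) → Fin (2 * k) → ℝ) : ℝ :=
    ∑ I : Fin (2 * k) → Fin (2 * k), (if I (fstPos 0) = i then
      raisedVolForm H y i I * ∑ s : Fin k → Fin (2 * k), ∑ t : Fin k → Fin (2 * k),
        Φ s t * c (t 0) (s 0) (I (sndPos 0)) * ∏ a ∈ Finset.univ.erase (0 : Fin k),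
          weylUp H y (t a) (s a) (I (fstPos a)) (I (sndPos a)) else 0)
  have hrho : ∀ H, rho k Φ H y i = (1 / ((2 * k - 1).factorial : ℝ)) *
      first H (cottonUpSecond H y) + (1 / (2 * (k : ℝ))) * pderiv i (pontrjaginWeyl k Φ H) y :=
    fun H => rfl
  have hvar : 2 * (k : ℝ) * first G (fun a b c => ∑ l, grad G u y l * weylUp G y a b l c) = _ :=
    h.metric.sum_raisedVolForm_weyl hy hΦ i
  have hfirst : first G' (cottonUpSecond G' y) = Real.exp (-(2 * k) * u y) *
      (first G (cottonUpSecond G y)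
        + first G (fun a b c => ∑ l, grad G u y l * weylUp G y a b l c)) := by
    simp only [first]
    rw [← Finset.sum_add_distrib, Finset.mul_sum]
    refine Finset.sum_congr rfl fun I _ => ?_
    split_ifs
    · simp_rw [h.raisedVolForm_eq hy, h.weylUp_eq hy, h.cottonUpSecond_eq two_le_two_mul hy]
      rw [← mul_add, ← Finset.sum_add_distrib]
      simp_rw [← Finset.sum_add_distrib]
      have : ∀ s t : Fin k → Fin (2 * k), Φ s t * (Real.exp (-(2 * u y)) *
          (cottonUpSecond G y (t 0) (s 0) (I (sndPos 0))
            + ∑ l, grad G u y l * weylUp G y (t 0) (s 0) l (I (sndPos 0)))) *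
            ∏ a ∈ Finset.univ.erase (0 : Fin k),
              weylUp G y (t a) (s a) (I (fstPos a)) (I (sndPos a)) =
          Real.exp (-(2 * u y)) * (Φ s t * cottonUpSecond G y (t 0) (s 0) (I (sndPos 0)) *
            ∏ a ∈ Finset.univ.erase (0 : Fin k),
              weylUp G y (t a) (s a) (I (fstPos a)) (I (sndPos a))
            + Φ s t * (∑ l, grad G u y l * weylUp G y (t 0) (s 0) l (I (sndPos 0))) *
            ∏ a ∈ Finset.univ.erase (0 : Fin k),
              weylUp G y (t a) (s a) (I (fstPos a)) (I (sndPos a))) := by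
        intro s t
        ring
      simp_rw [this, ← Finset.mul_sum]
      rw [mul_assoc, mul_assoc, mul_left_comm (Real.exp (2 * u y)),
        mul_left_comm (raisedVolForm G y i I), ← mul_assoc (Real.exp (2 * u y)), exp_mul_exp_neg,
        one_mul]
    · simp
  have hexp : Real.exp (2 * k * u y) * Real.exp (-(2 * k) * u y) = 1 := by
    rw [neg_mul]
    exact exp_mul_exp_neg _
  rw [hrho, hrho, hfirst,
    h.pderiv_of_weight hy h.metric.smooth_pontrjaginWeyl (fun z hz => h.pontrjaginWeyl_eq hz)]
  generalize first G (cottonUpSecond G y) = T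
  generalize first G (fun a b c => ∑ l, grad G u y l * weylUp G y a b l c) = S at hvar ⊢
  have hS : S = pderiv i u y * ((2 * k).factorial * pontrjaginWeyl k Φ G y) / (2 * k) := by
    rw [eq_div_iff (by simpa using hk), ← hvar]
    ring
  rw [hS, hfac]
  generalize Real.exp (2 * k * u y) = e at hexp ⊢
  generalize Real.exp (-(2 * k) * u y) = e' at hexp ⊢
  generalize pontrjaginWeyl k Φ G y = p
  generalize pderiv i (pontrjaginWeyl k Φ G) y = dp
  generalize pderiv i u y = du
  generalize ((2 * k - 1).factorial : ℝ) = f at hf ⊢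
  have : e * (1 / f * (e' * (T + du * (2 * k * f * p) / (2 * k)))
      + 1 / (2 * (k : ℝ)) * (e' * (dp - 2 * k * du * p))) =
      (e * e') * (1 / f * T + 1 / (2 * (k : ℝ)) * dp) := by
    field_simp
    ring
  rw [this, hexp, one_mul]

end IsConformalOn

end LocalGeometry

/-! ### The metric in a chart -/

theorem OpenPartialHomeomorph.mdifferentiable_of_mem_maximalAtlas
    {n : ℕ} {M : Type*} [TopologicalSpace M] [ChartedSpace (EuclideanSpace ℝ (Fin n)) M]
    {φ : OpenPartialHomeomorph M (EuclideanSpace ℝ (Fin n))}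
    (hφ : φ ∈ IsManifold.maximalAtlas (𝓡 n) ∞ M) : φ.MDifferentiable (𝓡 n) (𝓡 n) :=
  ⟨(contMDiffOn_of_mem_maximalAtlas hφ).mdifferentiableOn (by simp),
    (contMDiffOn_symm_of_mem_maximalAtlas hφ).mdifferentiableOn (by simp)⟩

namespace PseudoRiemannianMetric

variable {n : ℕ} {M : Type*} [TopologicalSpace M] [ChartedSpace (EuclideanSpace ℝ (Fin n)) M]
  [IsManifold (𝓡 n) ∞ M]

/-- The coordinate vector fields of a chart are smooth. -/
theorem contMDiffOn_coordinateVector {φ : OpenPartialHomeomorph M (EuclideanSpace ℝ (Fin n))}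
    (hφ : φ ∈ IsManifold.maximalAtlas (𝓡 n) ∞ M) (v : EuclideanSpace ℝ (Fin n)) :
    ContMDiffOn (𝓡 n) (𝓡 n).tangent ∞ (fun y => (Bundle.TotalSpace.mk' (EuclideanSpace ℝ (Fin n))
      (E := fun x : M => TangentSpace (𝓡 n) x) (φ.symm y) (mfderiv (𝓡 n) (𝓡 n) φ.symm y v)))
      φ.target := by
  have h1 := (contMDiffOn_symm_of_mem_maximalAtlas hφ).contMDiffOn_tangentMapWithin (m := ∞)
    (by simp) φ.open_target.uniqueMDiffOn
  have h2 : ContMDiffOn (𝓡 n) (𝓡 n).tangent ∞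
      (fun y : EuclideanSpace ℝ (Fin n) => (Bundle.TotalSpace.mk' (EuclideanSpace ℝ (Fin n))
        (E := fun x : EuclideanSpace ℝ (Fin n) => TangentSpace (𝓡 n) x) y v)) φ.target :=
    contMDiffOn_vectorSpace_iff_contDiffOn.2 contDiffOn_const
  refine (h1.comp h2 fun y hy => hy).congr fun y hy => ?_
  simp only [Function.comp, tangentMapWithin, Bundle.TotalSpace.mk']
  rw [mfderivWithin_of_isOpen φ.open_target hy]

theorem contDiffOn_inChart (g : PseudoRiemannianMetric n M)
    {φ : OpenPartialHomeomorph M (EuclideanSpace ℝ (Fin n))}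
    (hφ : φ ∈ IsManifold.maximalAtlas (𝓡 n) ∞ M) (i j : Fin n) :
    ContDiffOn ℝ ∞ (fun y => g.inChart φ y i j) φ.target := by
  rw [← contMDiffOn_iff_contDiffOn]
  have h : ContMDiffOn (𝓡 n) ((𝓡 n).prod 𝓘(ℝ)) ∞
      (fun y => Bundle.TotalSpace.mk' ℝ (E := Bundle.Trivial M ℝ) (φ.symm y)
        (g.inChart φ y i j)) φ.target := by
    refine ContMDiffOn.clm_bundle_apply₂ (F₁ := EuclideanSpace ℝ (Fin n))
      (F₂ := EuclideanSpace ℝ (Fin n)) ?_ (contMDiffOn_coordinateVector hφ _)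
      (contMDiffOn_coordinateVector hφ _)
    exact g.contMDiff.comp_contMDiffOn (contMDiffOn_symm_of_mem_maximalAtlas hφ)
  intro y hy
  have := h y hy
  simp only [Bundle.contMDiffWithinAt_totalSpace] at this
  exact this.2

theorem det_inChart_ne_zero (g : PseudoRiemannianMetric n M)
    {φ : OpenPartialHomeomorph M (EuclideanSpace ℝ (Fin n))}
    (hφ : φ ∈ IsManifold.maximalAtlas (𝓡 n) ∞ M) {y : EuclideanSpace ℝ (Fin n)}
    (hy : y ∈ φ.target) : (g.inChart φ y).det ≠ 0 := by
  intro h0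
  obtain ⟨v, hv, hv0⟩ := Matrix.exists_mulVec_eq_zero_iff.2 h0
  have hbij := (OpenPartialHomeomorph.mdifferentiable_of_mem_maximalAtlas hφ).symm.mfderiv_bijective hy
  set D := mfderiv (𝓡 n) (𝓡 n) φ.symm y with hD
  set e : Fin n → EuclideanSpace ℝ (Fin n) := fun i => EuclideanSpace.single i (1 : ℝ) with he
  have hsum : ∀ w : EuclideanSpace ℝ (Fin n), w = ∑ i, w i • e i := by
    intro w
    ext a
    simp [he, Pi.single_apply]
  have hDsum : ∀ w : EuclideanSpace ℝ (Fin n), D w = ∑ i, w i • D (e i) := by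
    intro w
    conv_lhs => rw [hsum w]
    exact (map_sum D _ _).trans (Finset.sum_congr rfl fun i _ => map_smul D _ _)
  have hrow : ∀ i, g.val (φ.symm y) (D (e i)) (D (WithLp.toLp 2 v)) = 0 := by
    intro i
    rw [hDsum (WithLp.toLp 2 v), map_sum]
    simp only [map_smul, smul_eq_mul]
    exact Eq.trans (Finset.sum_congr rfl fun j _ => mul_comm _ _) (congrFun hv0 i)
  have key : D (WithLp.toLp 2 v) = 0 := by
    refine g.nondegenerate _ _ fun w => ?_
    obtain ⟨w', rfl⟩ := hbij.2 w
    rw [g.symm, hDsum w', map_sum, sum_apply]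
    exact Finset.sum_eq_zero fun i _ => by rw [map_smul, smul_apply, hrow i, smul_zero]
  have h1 : WithLp.toLp 2 v = (0 : EuclideanSpace ℝ (Fin n)) :=
    hbij.1 (key.trans (map_zero D).symm)
  exact hv (by simpa using h1)

theorem isMetricOn_inChart (g : PseudoRiemannianMetric n M)
    {φ : OpenPartialHomeomorph M (EuclideanSpace ℝ (Fin n))}
    (hφ : φ ∈ IsManifold.maximalAtlas (𝓡 n) ∞ M) :
    LocalGeometry.IsMetricOn (g.inChart φ) φ.target where
  isOpen := φ.open_target
  smooth := g.contDiffOn_inChart hφ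
  symm _ _ _ _ := g.symm _ _ _
  det_ne_zero _ hz := g.det_inChart_ne_zero hφ hz

theorem isConformalOn_inChart (g : PseudoRiemannianMetric n M) (Υ : C^∞⟮𝓡 n, M; ℝ⟯)
    {φ : OpenPartialHomeomorph M (EuclideanSpace ℝ (Fin n))}
    (hφ : φ ∈ IsManifold.maximalAtlas (𝓡 n) ∞ M) :
    LocalGeometry.IsConformalOn (g.inChart φ) ((g.conformal Υ).inChart φ)
      (fun y => Υ (φ.symm y)) φ.target where
  metric := g.isMetricOn_inChart hφ
  smooth_factor := (Υ.contMDiff.comp_contMDiffOn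
    (contMDiffOn_symm_of_mem_maximalAtlas hφ)).contDiffOn
  eq_smul _ _ := rfl

end PseudoRiemannianMetric

theorem smul_covectorInChart {n : ℕ} {M : Type*} [TopologicalSpace M]
    [ChartedSpace (EuclideanSpace ℝ (Fin n)) M] [IsManifold (𝓡 n) ∞ M]
    (φ : OpenPartialHomeomorph M (EuclideanSpace ℝ (Fin n))) (x : M) (r : ℝ) (c : Fin n → ℝ) :
    r • covectorInChart φ x c = covectorInChart φ x fun i => r * c i := by
  simp only [covectorInChart, Finset.smul_sum, smul_smul]

theorem mainTheorem3 (k : ℕ) [NeZero k] {M : Type*} [TopologicalSpace M]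
    [ChartedSpace (EuclideanSpace ℝ (Fin (2 * k))) M] [IsManifold (𝓡 (2 * k)) ∞ M]
    (g : PseudoRiemannianMetric (2 * k) M) (Υ : C^∞⟮𝓡 (2 * k), M; ℝ⟯) :
    (∀ φ ∈ IsManifold.maximalAtlas (𝓡 (2 * k)) ∞ M, ∀ x ∈ φ.source,
      Real.exp (2 * (k : ℝ) * Υ x) • (g.conformal Υ).xi k φ x = g.xi k φ x) ∧
    (∀ (A : OrientedAtlas (2 * k) M) (Φ : (Fin k → Fin (2 * k)) → (Fin k → Fin (2 * k)) → ℝ),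
      LocalGeometry.IsInvariantPolynomial (2 * k) k Φ →
      ∀ φ ∈ A.charts, ∀ x ∈ φ.source,
        Real.exp (2 * (k : ℝ) * Υ x) • (g.conformal Υ).rho Φ φ x = g.rho Φ φ x) := by
  refine ⟨fun φ hφ x hx => ?_, fun A Φ hΦ φ hφA x hx => ?_⟩
  · have h := g.isConformalOn_inChart Υ hφ
    rw [PseudoRiemannianMetric.xi, PseudoRiemannianMetric.xi, smul_covectorInChart]
    congr 1
    funext i
    have := h.xi_eq (φ.map_source hx) i
    simpa only [φ.left_inv hx] using this
  · have h := g.isConformalOn_inChart Υ (A.subset_maximalAtlas hφA)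
    rw [PseudoRiemannianMetric.rho, PseudoRiemannianMetric.rho, smul_covectorInChart]
    congr 1
    funext i
    have := h.rho_eq (φ.map_source hx) hΦ i
    simpa only [φ.left_inv hx] using this
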